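/- **Setting.** Let $G=(V,E)$ be a directed acyclic graph with $n=|V|$ and $m=|E|$. A *shortcut* of $G$ is a set $H$ of additional directed edges (between distinct vertices, not in $E$) such that any two vertices $s,t$ with $t$ unreachable from $s$ in $G$ remain so in $G\cup H$. It is *certified* if for every $(u,v)\in H$ there is $w\in V$ with $(u,w),(w,v)\in E\cup H$. The *certification complexity* of a shortcut $H$ is the smallest size of a certified shortcut $H'\supseteq H$. A *chain* is a sequence of distinct vertices each of which reaches the next. For $C\ge 1$, an *$\ell$-chain cover with constant $C$* is a collection of at most $\ell$ vertex-disjoint chains such that every path of $G$ has at most $C\,n/\ell$ vertices lying on no chain. The *Kogan–Parter shortcut* for a chain cover $\mathcal C$, sampling probabilities $p,q$ and a shortcut $H_1$ of $G$ (in the algorithm: one that shortcuts the chains; $H_1=\emptyset$ is allowed) is $H=H_1\cup H_2$. Here each vertex is sampled with probability $p$ and each chain of $\mathcal C$ with probability $q$, all independently, and $H_2$ consists of the edges from each sampled vertex to the first vertex reachable from it on each sampled chain (omitting loops and edges of $G$). The notation $f=\tilde\Theta(g)$ means that $a\,g(n)/\log^b n\le f(n)\le A\,g(n)\log^b n$ for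 all large $n$, for some constants $a,A>0$ and $b\in\mathbb N$. **Lemma.** Let $\epsilon\in[0,2/75)$ and $C\ge 1$. There are constants $c_1,c_2,c_3>0$ and directed acyclic graphs $G_n$ ($n\in\mathbb N$), $G_n$ having $n$ vertices and $m_n$ edges, such that $c_1n^{1+\epsilon}\le m_n\le c_2n^{1+\epsilon}$ for all sufficiently large $n$, and such that the following holds for all $p,q:\mathbb N\to[0,1]$ with $p(n),q(n)=\tilde\Theta(n^{-1/3})$ and every $K\in\mathbb N$. For all sufficiently large $n$, all integers $\ell$ with $n^{2/3}/C\le\ell\le C\,n^{2/3}$, every $\ell$-chain cover $\mathcal C$ of $G_n$ with constant $C$ and every shortcut $H_1$ of $G_n$, the Kogan–Parter shortcut of $G_n$ for $\mathcal C$, $p(n)$, $q(n)$, $H_1$ has certification complexity at least $c_3\,m_n\,n^{\epsilon}$ with probability at least $1-n^{-K}$. -/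

import Mathlib

open Filter MeasureTheory ProbabilityTheory

namespace CertShortcut

/-- `t` is reachable from `s` in the directed graph `G` (every vertex reaches itself). -/
def Reach {V : Type*} (G : Digraph V) (s t : V) : Prop :=
  Relation.ReflTransGen G.Adj s t

/-- `G` is a directed acyclic graph: there is no closed walk of positive length. -/
def IsDAG {V : Type*} (G : Digraph V) : Prop :=
  ∀ v, ¬ Relation.TransGen G.Adj v v

/-- The number `m` of edges of a directed graph. -/
noncomputable def numEdges {V : Type*} (G : Digraph V) : ℕ :=
  {e : V × V | G.Adj e.1 e.2}.ncard

/-- The graph `G ∪ H` obtained by adding the edges of `H` to `G`. -/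
def addEdges {V : Type*} (G : Digraph V) (H : Set (V × V)) : Digraph V where
  Adj u v := G.Adj u v ∨ (u, v) ∈ H

/-- A shortcut of `G`: a set `H` of additional edges (between distinct vertices, and not already
in `G`) such that a vertex that is not reachable in `G` stays unreachable in `G ∪ H`. -/
structure IsShortcut {V : Type*} (G : Digraph V) (H : Set (V × V)) : Prop where
  additional : ∀ u v, (u, v) ∈ H → u ≠ v ∧ ¬ G.Adj u v
  reach_of_reach : ∀ s t, Reach (addEdges G H) s t → Reach G s t

/-- `H` is certified: each edge `(u, v)` of `H` comes with two edges `(u, w)`, `(w, v)` of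
`E ∪ H`. -/
def IsCertified {V : Type*} (G : Digraph V) (H : Set (V × V)) : Prop :=
  ∀ u v, (u, v) ∈ H → ∃ w, (addEdges G H).Adj u w ∧ (addEdges G H).Adj w v

/-- The certification complexity of a shortcut `H`: the smallest size of a certified shortcut
`H' ⊇ H`. Such an `H'` exists for every shortcut `H`, see
`certificationComplexity_attained`. -/
noncomputable def certificationComplexity {V : Type*} (G : Digraph V) (H : Set (V × V)) : ℕ :=
  sInf {k | ∃ H' : Set (V × V), IsShortcut G H' ∧ IsCertified G H' ∧ H ⊆ H' ∧ H'.ncard = k}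

/-- A chain of `G`: a sequence of distinct vertices, each of which reaches the next one. -/
def IsVertexChain {V : Type*} (G : Digraph V) (c : List V) : Prop :=
  c.Nodup ∧ c.IsChain (Reach G)

/-- The chains `c 0, …, c (k - 1)` form an `ℓ`-chain cover of `G`: there are at most `ℓ` of them,
they are vertex-disjoint, and every path of `G` has at most `C * (n / ℓ)` vertices that lie on no
chain, where `n` is the number of vertices of `G`. -/
structure IsChainCover {V : Type*} (G : Digraph V) {k : ℕ} (c : Fin k → List V) (ℓ : ℕ)
    (C : ℝ) : Prop where
  card_le : k ≤ ℓ
  isChain : ∀ i, IsVertexChain G (c i)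
  disjoint : ∀ i j, i ≠ j → List.Disjoint (c i) (c j)
  uncovered_le : ∀ P : List V, P.Nodup → P.IsChain G.Adj →
    ({v | v ∈ P ∧ ∀ i, v ∉ c i}.ncard : ℝ) ≤ C * ((Nat.card V : ℝ) / ℓ)

open Classical in
/-- The edges that join every sampled vertex `u ∈ A` to the first vertex reachable from `u` on every
sampled chain `c i`, `i ∈ B` (only new edges between distinct vertices are added). -/
def sampledEdges {V : Type*} (G : Digraph V) {k : ℕ} (c : Fin k → List V)
    (A : Set V) (B : Set (Fin k)) : Set (V × V) :=
  {e | e.1 ∈ A ∧ (∃ i ∈ B, (c i).find? (fun w => decide (Reach G e.1 w)) = some e.2) ∧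
    e.1 ≠ e.2 ∧ ¬ G.Adj e.1 e.2}

/-- The Kogan–Parter vertex-and-path sampling shortcut `H₁ ∪ H₂`. The first part `H₁` shortcuts the
chains themselves; the second part `H₂` joins the sampled vertices to the sampled chains. -/
def koganParter {V : Type*} (G : Digraph V) {k : ℕ} (c : Fin k → List V) (H₁ : Set (V × V))
    (A : Set V) (B : Set (Fin k)) : Set (V × V) :=
  H₁ ∪ sampledEdges G c A B

/-- The law of the sample: every vertex is taken with probability `p`, every chain with probability
`q`, all independently. -/
noncomputable def sampleLaw (V : Type*) (k : ℕ) (p q : unitInterval) :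
    Measure (Set V × Set (Fin k)) :=
  (setBernoulli (Set.univ : Set V) p).prod (setBernoulli (Set.univ : Set (Fin k)) q)

/-- `f = Θ̃(g)`: the two agree up to constant and polylogarithmic factors. -/
def IsSoftTheta (f g : ℕ → ℝ) : Prop :=
  ∃ a A : ℝ, ∃ b : ℕ, 0 < a ∧ 0 < A ∧ ∀ᶠ n : ℕ in atTop,
    a * g n / Real.log n ^ b ≤ f n ∧ f n ≤ A * g n * Real.log n ^ b

theorem reach_addEdges {V : Type*} {G : Digraph V} {H : Set (V × V)}
    (h : ∀ u v, (u, v) ∈ H → Reach G u v) {s t : V} (hst : Reach (addEdges G H) s t) :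
    Reach G s t := by
  induction hst with
  | refl => exact Relation.ReflTransGen.refl
  | tail _ hbc ih =>
    rcases hbc with hbc | hbc
    · exact ih.tail hbc
    · exact Relation.ReflTransGen.trans ih (h _ _ hbc)

theorem IsShortcut.reach {V : Type*} {G : Digraph V} {H : Set (V × V)} (h : IsShortcut G H)
    {u v : V} (huv : (u, v) ∈ H) : Reach G u v :=
  h.reach_of_reach u v (Relation.ReflTransGen.single (Or.inr huv))

/-- The Kogan–Parter set is a shortcut whenever its first part is. -/
theorem isShortcut_koganParter {V : Type*} {G : Digraph V} {k : ℕ} (c : Fin k → List V)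
    {H₁ : Set (V × V)} (h : IsShortcut G H₁) (A : Set V) (B : Set (Fin k)) :
    IsShortcut G (koganParter G c H₁ A B) where
  additional u v huv := by
    rcases huv with huv | huv
    · exact h.additional u v huv
    · exact huv.2.2
  reach_of_reach s t hst := by
    refine reach_addEdges ?_ hst
    rintro u v (huv | ⟨-, ⟨i, -, hi⟩, -⟩)
    · exact h.reach huv
    · simpa using List.find?_some hi

/-- Every shortcut has a certified extension, so that its certification
complexity is attained. -/
theorem certificationComplexity_attained {V : Type*} {G : Digraph V}
    {H : Set (V × V)} (h : IsShortcut G H) :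
    ∃ H' : Set (V × V), IsShortcut G H' ∧ IsCertified G H' ∧ H ⊆ H' ∧
      H'.ncard = certificationComplexity G H := by
  refine Nat.sInf_mem (s := {k | ∃ H' : Set (V × V), IsShortcut G H' ∧ IsCertified G H' ∧
    H ⊆ H' ∧ H'.ncard = k}) ?_
  refine ⟨_, {e | Reach G e.1 e.2 ∧ e.1 ≠ e.2 ∧ ¬ G.Adj e.1 e.2}, ⟨?_, ?_⟩, ?_, ?_, rfl⟩
  · exact fun u v huv => huv.2
  · exact fun s t hst => reach_addEdges (fun u v huv => huv.1) hst
  · rintro u v ⟨hr, hne, hadj⟩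
    rcases Relation.ReflTransGen.cases_head hr with heq | ⟨w, huw, hwv⟩
    · exact absurd heq hne
    · refine ⟨w, Or.inl huw, ?_⟩
      by_cases hw : G.Adj w v
      · exact Or.inl hw
      · refine Or.inr ⟨hwv, fun heq => ?_, hw⟩
        have heq' : w = v := heq
        exact hadj (heq' ▸ huw)
  · rintro ⟨u, v⟩ huv
    exact ⟨h.reach huv, h.additional u v huv⟩

end CertShortcut

/-! The hard graph is a layered graph with `3 * D + 1` layers that feeds long paths, the rails.
Layer `j` moves coordinate `j % 3` of a point of `ℕ³` by some `a < Δ` and raises a height by `a ^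
2`; a point `D • g` of the last layer at height `i` leads to position `i` of each of `J` rails named
`g`. By strict convexity of the square, the cheapest way from `D • x` to `D • (x + α)` takes the
constant step `α` in each direction, and it is the only cheapest way. So this critical path enters
the rails `x + α` at the first position that its source reaches, and every vertex between its ends
lies on it (`eq_crit_of_reach`).

An edge of a certified shortcut that joins the ends of a critical path therefore unfolds,
certificate by certificate, into a binary subdivision of that path. This uses linearly many pairs at
distance at least `5` on the path (`sub_le_card_longPairs`). Two points that far apart determine
`x`, `y` and `α` (`crit_determined`), so different critical paths pay with different edges, and a
certified shortcut has about `D` times as many edges as it spans critical paths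
(`card_mul_le_ncard`).

It remains to force the Kogan–Parter edges to span many critical paths. A rail leads only into
itself. Hence, if a rail vertex comes on a chain after another rail vertex, it is the first vertex
of the chain that is reachable from the source of any critical path ending there (`find_eq_some`).
Few rail vertices fail to be late in this sense: those on no chain, and at most one per chain
(`card_badPairs_le`). So at least half of the pairs (rail name, position) are met late on at least
half of their `J` rails, necessarily by different chains. Every source comes in `K` copies. As `J`
and `K` exceed `n ^ (1 / 3)` by a small power of `n`, with high probability each source has a
sampled copy and each good target a sampled chain (`one_sub_le_prob`). This yields order `Δ ^ 6 * Y
* D` certificate edges, more than `n ^ (1 + 2 * ε)` for the chosen parameters; a complete bipartite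
padding adjusts the number of edges. -/

namespace CertShortcut

/-! ### Certificates along a path as binary subdivisions -/

section Triangulation

variable {V : Type*} {G : Digraph V} {H : Set (V × V)}

open Classical in
/-- The index pairs between `a` and `b` at distance at least `5` whose image under `p` lies
in `H`. -/
noncomputable def longPairs (H : Set (V × V)) (p : ℕ → V) (a b : ℕ) : Finset (ℕ × ℕ) :=
  (Finset.range (b + 1) ×ˢ Finset.range (b + 1)).filter
    fun e => a ≤ e.1 ∧ e.1 + 5 ≤ e.2 ∧ (p e.1, p e.2) ∈ H

theorem mem_longPairs {p : ℕ → V} {a b : ℕ} {e : ℕ × ℕ} :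
    e ∈ longPairs H p a b ↔ a ≤ e.1 ∧ e.1 + 5 ≤ e.2 ∧ e.2 ≤ b ∧ (p e.1, p e.2) ∈ H := by
  simp only [longPairs, Finset.mem_filter, Finset.mem_product, Finset.mem_range]
  constructor
  · rintro ⟨⟨h1, h2⟩, h3, h4, h5⟩
    exact ⟨h3, h4, by omega, h5⟩
  · rintro ⟨h3, h4, h2, h5⟩
    exact ⟨⟨by omega, by omega⟩, h3, h4, h5⟩

/-- Pairs inside `[a, k]` and inside `[k, b]` cannot coincide, and `(a, b)` is inside neither: one
subdivision step gains the pair being subdivided. -/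
theorem card_longPairs_add {p : ℕ → V} {a k b : ℕ} (hak : a < k) (hkb : k < b)
    (hab : a + 5 ≤ b) (h : (p a, p b) ∈ H) :
    (longPairs H p a k).card + (longPairs H p k b).card + 1 ≤ (longPairs H p a b).card := by
  classical
  have hdisj : Disjoint (longPairs H p a k) (longPairs H p k b) := by
    rw [Finset.disjoint_left]
    intro e h1 h2
    rw [mem_longPairs] at h1 h2
    omega
  have hnot : (a, b) ∉ longPairs H p a k ∪ longPairs H p k b := by
    rw [Finset.mem_union, mem_longPairs, mem_longPairs]
    simp only
    omega
  rw [← Finset.card_union_of_disjoint hdisj, ← Finset.card_insert_of_notMem hnot]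
  apply Finset.card_le_card
  intro e he
  rw [Finset.mem_insert, Finset.mem_union, mem_longPairs, mem_longPairs] at he
  rw [mem_longPairs]
  rcases he with rfl | ⟨h1, h2, h3, h4⟩ | ⟨h1, h2, h3, h4⟩
  · exact ⟨le_rfl, hab, le_rfl, h⟩
  · exact ⟨h1, h2, by omega, h4⟩
  · exact ⟨by omega, h2, h3, h4⟩

/-- If every certificate of a pair on the path `p` is again on `p`, then the certificates of an
edge spanning `p` contain many pairs that are far apart on `p`. -/
theorem sub_le_card_longPairs (hc : IsCertified G H) (p : ℕ → V) (N : ℕ)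
    (hadj : ∀ a b, a + 2 ≤ b → b ≤ N → ¬ G.Adj (p a) (p b))
    (hmid : ∀ a b w, a ≤ b → b ≤ N → (addEdges G H).Adj (p a) w →
      (addEdges G H).Adj w (p b) → ∃ k, a < k ∧ k < b ∧ w = p k)
    (d : ℕ) : ∀ a, a + d ≤ N → (addEdges G H).Adj (p a) (p (a + d)) →
      d ≤ 4 * (longPairs H p a (a + d)).card + 4 := by
  induction d using Nat.strong_induction_on with
  | _ d ih =>
    intro a hN h
    -- Short pairs are paid for by the additive constant `4`.
    by_cases hd : d < 5
    · omega
    have hH : (p a, p (a + d)) ∈ H := h.resolve_left (hadj _ _ (by omega) hN)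
    obtain ⟨w, h1, h2⟩ := hc _ _ hH
    obtain ⟨k, hk1, hk2, rfl⟩ := hmid _ _ _ (by omega) hN h1 h2
    have e1 := ih (k - a) (by omega) a (by omega) (by rwa [Nat.add_sub_cancel' hk1.le])
    have e2 := ih (a + d - k) (by omega) k (by omega) (by rwa [Nat.add_sub_cancel' hk2.le])
    rw [Nat.add_sub_cancel' hk1.le] at e1
    rw [Nat.add_sub_cancel' hk2.le] at e2
    -- Adding the two inductive bounds produces the constant `4` twice; the pair `(a, a + d)` itself
    -- absorbs one of them.
    have := card_longPairs_add (a := a) (b := a + d) hk1 hk2 (by omega) hH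
    omega

end Triangulation

section Lists

theorem pairwise_reach {V : Type*} {G : Digraph V} {c : List V} (h : IsVertexChain G c) :
    c.Pairwise (Reach G) := by
  have : IsTrans V (Reach G) := ⟨fun _ _ _ => Relation.ReflTransGen.trans⟩
  exact List.isChain_iff_pairwise.mp h.2

end Lists

/-! ### The universal graph and its reachability relation -/

/-- The vertices of the universal graph from which the hard instances are cut out: sources,
vertices of the layered graph, vertices of the long paths, and padding. -/
inductive Code where
  | leaf (x : Fin 3 → ℕ) (y κ : ℕ)
  | mid (j : ℕ) (x : Fin 3 → ℕ) (y : ℕ)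
  | rail (g : Fin 3 → ℕ) (j i : ℕ)
  | pad (i : ℕ)

/-- The index of the coordinate in which layer `j` moves. -/
def dir (j : ℕ) : Fin 3 := ⟨j % 3, Nat.mod_lt _ (by norm_num)⟩

/-- The displacement of the walk with step sizes `a` between the layers `j` and `j'`. -/
def disp (a : ℕ → ℕ) (j j' : ℕ) : Fin 3 → ℕ :=
  fun i => ∑ k ∈ Finset.Ico j j', if dir k = i then a k else 0

/-- The cost of the walk with step sizes `a` between the layers `j` and `j'`. -/
def cost (a : ℕ → ℕ) (j j' : ℕ) : ℕ := ∑ k ∈ Finset.Ico j j', a k ^ 2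

/-- The edges of the universal graph. -/
inductive CodeAdj (D Δ A B : ℕ) : Code → Code → Prop where
  | enter (x : Fin 3 → ℕ) (y κ : ℕ) : CodeAdj D Δ A B (.leaf x y κ) (.mid 0 (D • x) y)
  | step (j : ℕ) (x : Fin 3 → ℕ) (y a : ℕ) (ha : a < Δ) :
      CodeAdj D Δ A B (.mid j x y)
        (.mid (j + 1) (x + fun i => if dir j = i then a else 0) (y + a ^ 2))
  | exit (x g : Fin 3 → ℕ) (l j i : ℕ) (hl : l = 3 * D) (hx : x = D • g) :
      CodeAdj D Δ A B (.mid l x i) (.rail g j i)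
  | next (g : Fin 3 → ℕ) (j i : ℕ) : CodeAdj D Δ A B (.rail g j i) (.rail g j (i + 1))
  | pad (i j : ℕ) (hi : i < A) (hj : A ≤ j) (hj' : j < A + B) : CodeAdj D Δ A B (.pad i) (.pad j)

/-- The universal graph. -/
def codeGraph (D Δ A B : ℕ) : Digraph Code := ⟨CodeAdj D Δ A B⟩

/-- A topological ordering of the universal graph. -/
def Code.rank (D : ℕ) : Code → ℕ
  | .leaf _ _ _ => 0
  | .mid j _ _ => j + 1
  | .rail _ _ i => 3 * D + 2 + i
  | .pad i => i

section Reach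

variable {D Δ A B : ℕ}

theorem CodeAdj.rank_lt {u v : Code} (h : CodeAdj D Δ A B u v) : u.rank D < v.rank D := by
  cases h <;> simp only [Code.rank] <;> omega

theorem rank_le_of_reach {u v : Code} (h : Reach (codeGraph D Δ A B) u v) :
    u.rank D ≤ v.rank D := by
  induction h with
  | refl => exact le_rfl
  | tail _ h ih => exact ih.trans (CodeAdj.rank_lt h).le

theorem reach_rail {g : Fin 3 → ℕ} {j i : ℕ} {v : Code}
    (h : Reach (codeGraph D Δ A B) (.rail g j i) v) : ∃ i', i ≤ i' ∧ v = .rail g j i' := by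
  induction h with
  | refl => exact ⟨i, le_rfl, rfl⟩
  | tail _ h ih =>
    obtain ⟨i', hi, rfl⟩ := ih
    cases h
    exact ⟨i' + 1, by omega, rfl⟩

theorem disp_self (a : ℕ → ℕ) (j : ℕ) : disp a j j = 0 := by
  ext i; simp [disp]

theorem cost_self (a : ℕ → ℕ) (j : ℕ) : cost a j j = 0 := by
  simp [cost]

theorem disp_congr {a a' : ℕ → ℕ} {j j' : ℕ} (h : ∀ k, j ≤ k → k < j' → a k = a' k) :
    disp a j j' = disp a' j j' := by
  ext i
  refine Finset.sum_congr rfl fun k hk => ?_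
  rw [Finset.mem_Ico] at hk
  rw [h k hk.1 hk.2]

theorem cost_congr {a a' : ℕ → ℕ} {j j' : ℕ} (h : ∀ k, j ≤ k → k < j' → a k = a' k) :
    cost a j j' = cost a' j j' := by
  refine Finset.sum_congr rfl fun k hk => ?_
  rw [Finset.mem_Ico] at hk
  rw [h k hk.1 hk.2]

theorem disp_succ (a : ℕ → ℕ) {j j' : ℕ} (h : j ≤ j') :
    disp a j (j' + 1) = disp a j j' + fun i => if dir j' = i then a j' else 0 := by
  ext i; simp [disp, Finset.sum_Ico_succ_top h]

theorem cost_succ (a : ℕ → ℕ) {j j' : ℕ} (h : j ≤ j') :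
    cost a j (j' + 1) = cost a j j' + a j' ^ 2 := by
  simp [cost, Finset.sum_Ico_succ_top h]

theorem disp_add (a : ℕ → ℕ) {j k l : ℕ} (h : j ≤ k) (h' : k ≤ l) :
    disp a j k + disp a k l = disp a j l := by
  ext i; exact Finset.sum_Ico_consecutive _ h h'

theorem cost_add (a : ℕ → ℕ) {j k l : ℕ} (h : j ≤ k) (h' : k ≤ l) :
    cost a j k + cost a k l = cost a j l :=
  Finset.sum_Ico_consecutive _ h h'

/-- The vertices reachable from a vertex of the layered graph. -/
theorem reach_mid (hΔ : 0 < Δ) {j : ℕ} {x : Fin 3 → ℕ} {y : ℕ} {v : Code}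
    (h : Reach (codeGraph D Δ A B) (.mid j x y) v) :
    (∃ (a : ℕ → ℕ) (j' : ℕ), (∀ k, a k < Δ) ∧ j ≤ j' ∧
      v = .mid j' (x + disp a j j') (y + cost a j j')) ∨
    (∃ (a : ℕ → ℕ) (g : Fin 3 → ℕ) (r i : ℕ), (∀ k, a k < Δ) ∧ j ≤ 3 * D ∧
      D • g = x + disp a j (3 * D) ∧ y + cost a j (3 * D) ≤ i ∧ v = .rail g r i) := by
  induction h with
  | refl => exact Or.inl ⟨fun _ => 0, j, fun _ => hΔ, le_rfl, by simp [disp_self, cost_self]⟩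
  | tail _ h ih =>
    rcases ih with ⟨a, j', ha, hj, rfl⟩ | ⟨a, g, r, i, ha, hj, hg, hi, rfl⟩
    · rcases h with _ | ⟨_, _, _, b, hb⟩ | ⟨_, g, _, r, _, rfl, hg⟩
      · left
        -- Only the values of `a` on the layers already crossed matter, so the value at `j'` may be
        -- overwritten.
        refine ⟨Function.update a j' b, j' + 1, fun k => ?_, by omega, ?_⟩
        · by_cases hk : k = j'
          · subst hk; simpa using hb
          · simpa [hk] using ha k
        · have hcongr : ∀ k, j ≤ k → k < j' → a k = Function.update a j' b k := by
            intro k _ hk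
            rw [Function.update_of_ne (by omega)]
          rw [disp_succ _ hj, cost_succ _ hj, Function.update_self, ← disp_congr hcongr,
            ← cost_congr hcongr, add_assoc, add_assoc]
      · right
        exact ⟨a, g, r, _, ha, hj, hg.symm, le_rfl, rfl⟩
    · cases h
      exact Or.inr ⟨a, g, r, i + 1, ha, hj, hg, by omega, rfl⟩

end Reach

/-! ### Constant step sizes are the unique cheapest ones -/

section Convexity

theorem sum_range_dir {M : Type*} [AddCommMonoid M] (f : Fin 3 → M) (D : ℕ) :
    ∑ k ∈ Finset.Ico 0 (3 * D), f (dir k) = D • ∑ i, f i := by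
  rw [← Finset.range_eq_Ico]
  induction D with
  | zero => simp
  | succ D ih =>
    have h0 : dir (3 * D) = 0 := by ext; simp [dir]
    have h1 : dir (3 * D + 1) = 1 := by ext; simp [dir]
    have h2 : dir (3 * D + 2) = 2 := by ext; simp [dir]
    rw [show 3 * (D + 1) = 3 * D + 1 + 1 + 1 by ring, Finset.sum_range_succ,
      Finset.sum_range_succ, Finset.sum_range_succ, ih, h0, h1, h2, Fin.sum_univ_three,
      succ_nsmul]
    abel

/-- Each coordinate moves in exactly `D` of the `3 * D` layers. Sources enter at `D • x`, so a
constant walk ends at `D • (x + α)`, where rails are attached. -/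
theorem disp_const (α : Fin 3 → ℕ) (D : ℕ) : disp (α ∘ dir) 0 (3 * D) = D • α := by
  ext i
  have := sum_range_dir (fun i' => if i' = i then α i' else 0) D
  simpa [disp] using this

theorem cost_const (α : Fin 3 → ℕ) (D : ℕ) :
    cost (α ∘ dir) 0 (3 * D) = D * ∑ i, α i ^ 2 := by
  have := sum_range_dir (fun i => α i ^ 2) D
  simpa [cost] using this

/-- Expand the squared deviations: the prescribed total displacement fixes the cross term, so the
excess cost over the constant walk is exactly the sum of squared deviations. Minimality and
uniqueness both follow. -/
theorem cost_eq_add_sq {b : ℕ → ℕ} {α : Fin 3 → ℕ} {D : ℕ}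
    (h : disp b 0 (3 * D) = D • α) :
    (cost b 0 (3 * D) : ℤ) = D * ∑ i, (α i : ℤ) ^ 2 +
      ∑ k ∈ Finset.Ico 0 (3 * D), ((b k : ℤ) - α (dir k)) ^ 2 := by
  have h1 : ∑ k ∈ Finset.Ico 0 (3 * D), (α (dir k) : ℤ) * b k = D * ∑ i, (α i : ℤ) ^ 2 := by
    have : ∀ k ∈ Finset.Ico 0 (3 * D), (α (dir k) : ℤ) * b k =
        ∑ i, (α i : ℤ) * (if dir k = i then b k else 0 : ℕ) := by
      intro k _
      simp
    rw [Finset.sum_congr rfl this, Finset.sum_comm, Finset.mul_sum]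
    refine Finset.sum_congr rfl fun i _ => ?_
    rw [← Finset.mul_sum, ← Nat.cast_sum]
    have hi := congrFun h i
    simp only [disp] at hi
    rw [hi]
    simp
    ring
  have h2 : ∑ k ∈ Finset.Ico 0 (3 * D), (α (dir k) : ℤ) ^ 2 = D * ∑ i, (α i : ℤ) ^ 2 := by
    simpa using sum_range_dir (fun i => (α i : ℤ) ^ 2) D
  have h3 : ∑ k ∈ Finset.Ico 0 (3 * D), ((b k : ℤ) - α (dir k)) ^ 2 =
      ∑ k ∈ Finset.Ico 0 (3 * D), (b k : ℤ) ^ 2 -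
        2 * ∑ k ∈ Finset.Ico 0 (3 * D), (α (dir k) : ℤ) * b k +
        ∑ k ∈ Finset.Ico 0 (3 * D), (α (dir k) : ℤ) ^ 2 := by
    rw [Finset.mul_sum, ← Finset.sum_sub_distrib, ← Finset.sum_add_distrib]
    exact Finset.sum_congr rfl fun k _ => by ring
  rw [h3, h1, h2, cost]
  push_cast
  ring

theorem le_cost {b : ℕ → ℕ} {α : Fin 3 → ℕ} {D : ℕ} (h : disp b 0 (3 * D) = D • α) :
    D * ∑ i, α i ^ 2 ≤ cost b 0 (3 * D) := by
  have h1 := cost_eq_add_sq h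
  have h2 : 0 ≤ ∑ k ∈ Finset.Ico 0 (3 * D), ((b k : ℤ) - α (dir k)) ^ 2 :=
    Finset.sum_nonneg fun k _ => sq_nonneg _
  zify
  linarith

theorem eq_of_cost_le {b : ℕ → ℕ} {α : Fin 3 → ℕ} {D : ℕ} (h : disp b 0 (3 * D) = D • α)
    (hc : cost b 0 (3 * D) ≤ D * ∑ i, α i ^ 2) {k : ℕ} (hk : k < 3 * D) : b k = α (dir k) := by
  have h1 := cost_eq_add_sq h
  have h2 : ∑ k ∈ Finset.Ico 0 (3 * D), ((b k : ℤ) - α (dir k)) ^ 2 ≤ 0 := by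
    zify at hc
    linarith
  have h3 : ((b k : ℤ) - α (dir k)) ^ 2 ≤ 0 :=
    (Finset.single_le_sum (f := fun k => ((b k : ℤ) - α (dir k)) ^ 2)
      (fun k _ => sq_nonneg _) (Finset.mem_Ico.2 ⟨Nat.zero_le k, hk⟩)).trans h2
  have h4 : (b k : ℤ) - α (dir k) = 0 := by
    have := le_antisymm h3 (sq_nonneg _)
    simpa using this
  omega

end Convexity

/-! ### Critical paths -/

/-- The critical path from `leaf x y κ` to the rail `x + α` with index `r`. -/
def crit (D : ℕ) (x : Fin 3 → ℕ) (y κ : ℕ) (α : Fin 3 → ℕ) (r : ℕ) : ℕ → Code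
  | 0 => .leaf x y κ
  | k + 1 =>
    if k ≤ 3 * D then .mid k (D • x + disp (α ∘ dir) 0 k) (y + cost (α ∘ dir) 0 k)
    else .rail (x + α) r (y + D * ∑ i, α i ^ 2)

section Crit

variable {D Δ A B : ℕ} {x : Fin 3 → ℕ} {y κ : ℕ} {α : Fin 3 → ℕ} {r : ℕ}

theorem crit_succ {k : ℕ} (hk : k ≤ 3 * D) : crit D x y κ α r (k + 1) =
    .mid k (D • x + disp (α ∘ dir) 0 k) (y + cost (α ∘ dir) 0 k) := by
  simp [crit, hk]

theorem crit_last : crit D x y κ α r (3 * D + 2) =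
    .rail (x + α) r (y + D * ∑ i, α i ^ 2) := by
  simp [crit]

theorem crit_adj (hα : ∀ i, α i < Δ) {k : ℕ} (hk : k < 3 * D + 2) :
    CodeAdj D Δ A B (crit D x y κ α r k) (crit D x y κ α r (k + 1)) := by
  rcases k with _ | k
  · rw [crit_succ (Nat.zero_le _), disp_self, cost_self]
    exact CodeAdj.enter _ _ _
  · by_cases h : k < 3 * D
    · rw [crit_succ h.le, crit_succ h, disp_succ _ (Nat.zero_le k), cost_succ _ (Nat.zero_le k),
        ← add_assoc, ← add_assoc]
      exact CodeAdj.step _ _ _ _ (hα _)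
    · obtain rfl : k = 3 * D := by omega
      rw [crit_succ le_rfl, crit_last, cost_const, disp_const]
      exact CodeAdj.exit _ _ _ _ _ rfl (smul_add _ _ _).symm

theorem crit_not_adj {a b : ℕ} (hab : a + 2 ≤ b) (hb : b ≤ 3 * D + 2) :
    ¬ CodeAdj D Δ A B (crit D x y κ α r a) (crit D x y κ α r b) := by
  intro h
  obtain ⟨b, rfl⟩ : ∃ b', b = b' + 1 := ⟨b - 1, by omega⟩
  rcases a with _ | a
  · by_cases hb' : b ≤ 3 * D
    · rw [crit_succ hb'] at h
      generalize hu : crit D x y κ α r 0 = u at h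
      generalize hv : Code.mid b _ _ = v at h
      cases h <;> simp_all [crit]
    · obtain rfl : b = 3 * D + 1 := by omega
      rw [crit_last] at h
      generalize hu : crit D x y κ α r 0 = u at h
      generalize hv : Code.rail _ _ _ = v at h
      cases h <;> simp_all [crit]
  · rw [crit_succ (by omega : a ≤ 3 * D)] at h
    by_cases hb' : b ≤ 3 * D
    · rw [crit_succ hb'] at h
      generalize hv : Code.mid b _ _ = v at h
      cases h
      · simp only [Code.mid.injEq] at hv
        omega
      · simp at hv
    · obtain rfl : b = 3 * D + 1 := by omega
      rw [crit_last] at h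
      generalize hv : Code.rail _ _ _ = v at h
      cases h
      · simp at hv
      · omega

theorem crit_rank {k : ℕ} (hk : k < 3 * D + 2) : (crit D x y κ α r k).rank D = k := by
  rcases k with _ | k
  · rfl
  · rw [crit_succ (by omega)]; rfl

theorem crit_rank_strictMono {a b : ℕ} (hab : a < b) (hb : b ≤ 3 * D + 2) :
    (crit D x y κ α r a).rank D < (crit D x y κ α r b).rank D := by
  rw [crit_rank (by omega)]
  rcases hb.eq_or_lt with rfl | hb
  · rw [crit_last]
    simp only [Code.rank]
    omega
  · rwa [crit_rank hb]

theorem crit_reach (hα : ∀ i, α i < Δ) {a b : ℕ} (hab : a ≤ b) (hb : b ≤ 3 * D + 2) :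
    Reach (codeGraph D Δ A B) (crit D x y κ α r a) (crit D x y κ α r b) := by
  induction b, hab using Nat.le_induction with
  | base => exact Relation.ReflTransGen.refl
  | succ b hab ih => exact (ih (by omega)).tail (crit_adj hα (by omega))

theorem reach_leaf {v : Code} (h : Reach (codeGraph D Δ A B) (.leaf x y κ) v) :
    v = .leaf x y κ ∨ Reach (codeGraph D Δ A B) (.mid 0 (D • x) y) v := by
  rcases Relation.ReflTransGen.cases_head h with h | ⟨w, h1, h2⟩
  · exact Or.inl h.symm
  · cases h1
    exact Or.inr h2

/-- The critical path reaches its rail at the first position that can be reached at all. -/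
theorem le_of_reach_rail (hΔ : 0 < Δ) {r' i : ℕ}
    (h : Reach (codeGraph D Δ A B) (.leaf x y κ) (.rail (x + α) r' i)) :
    y + D * ∑ i, α i ^ 2 ≤ i := by
  rcases reach_leaf h with h | h
  · cases h
  rcases reach_mid hΔ h with ⟨a, j', -, -, h⟩ | ⟨a, g, r, i', -, -, hg, hi, h⟩
  · cases h
  · cases h
    rw [smul_add] at hg
    have := le_cost (add_left_cancel hg).symm
    omega

/-- Every vertex between the ends of a critical path lies on the path. -/
theorem eq_crit_of_reach (hΔ : 0 < Δ) {w : Code}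
    (h1 : Reach (codeGraph D Δ A B) (.leaf x y κ) w)
    (h2 : Reach (codeGraph D Δ A B) w (.rail (x + α) r (y + D * ∑ i, α i ^ 2))) :
    ∃ k ≤ 3 * D + 2, w = crit D x y κ α r k := by
  rcases reach_leaf h1 with rfl | h
  · exact ⟨0, by omega, rfl⟩
  rcases reach_mid hΔ h with ⟨a, j, -, -, rfl⟩ | ⟨a, g, r', i', -, -, hg, hi, rfl⟩
  · rcases reach_mid hΔ h2 with ⟨a', j', -, -, h⟩ | ⟨a', g, r', i', -, hj, hg, hi, h⟩
    · cases h
    · cases h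
      -- The walk into `w` is glued to the walk out of `w`. The result reaches the rail no higher
      -- than the critical position, so it has minimal cost and equals the constant walk, and `w`
      -- lies on it.
      let b : ℕ → ℕ := fun k => if k < j then a k else a' k
      have hb1 : ∀ k, 0 ≤ k → k < j → a k = b k := fun k _ hk => by simp [b, hk]
      have hb2 : ∀ k, j ≤ k → k < 3 * D → a' k = b k := fun k hk _ => by simp [b, hk.not_gt]
      rw [disp_congr hb1, disp_congr hb2, add_assoc, disp_add _ (Nat.zero_le j) hj,
        smul_add] at hg
      rw [cost_congr hb1, cost_congr hb2, add_assoc, cost_add _ (Nat.zero_le j) hj] at hi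
      have hg' := (add_left_cancel hg).symm
      have key : ∀ k, 0 ≤ k → k < j → a k = (α ∘ dir) k := fun k hk hkj => by
        rw [hb1 k hk hkj]
        exact eq_of_cost_le hg' (by omega) (by omega)
      refine ⟨j + 1, by omega, ?_⟩
      rw [crit_succ hj, disp_congr key, cost_congr key]
  -- Here `w` is on the final rail, not after the endpoint; since no earlier position is reachable
  -- from the source, it is the endpoint.
  · obtain ⟨i'', hi'', h⟩ := reach_rail h2
    cases h
    have := le_of_reach_rail hΔ h1
    refine ⟨3 * D + 2, le_rfl, ?_⟩
    rw [crit_last]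
    congr
    omega

/-- Prolonging to both ends of the critical path reduces to `eq_crit_of_reach`; the ranks, which
increase along the path, then locate the index. -/
theorem crit_between (hΔ : 0 < Δ) (hα : ∀ i, α i < Δ) {a b : ℕ} {w : Code}
    (hab : a ≤ b) (hb : b ≤ 3 * D + 2)
    (h1 : Reach (codeGraph D Δ A B) (crit D x y κ α r a) w)
    (h2 : Reach (codeGraph D Δ A B) w (crit D x y κ α r b)) :
    ∃ k, a ≤ k ∧ k ≤ b ∧ w = crit D x y κ α r k := by
  have e1 : Reach (codeGraph D Δ A B) (.leaf x y κ) w :=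
    (crit_reach (r := r) hα (Nat.zero_le a) (hab.trans hb)).trans h1
  have e2 := h2.trans (crit_reach (r := r) hα hb le_rfl)
  rw [crit_last] at e2
  obtain ⟨k, hk, rfl⟩ := eq_crit_of_reach hΔ e1 e2
  refine ⟨k, ?_, ?_, rfl⟩
  · by_contra hlt
    have := crit_rank_strictMono (x := x) (y := y) (κ := κ) (α := α) (r := r)
      (not_le.1 hlt) (hab.trans hb)
    have := rank_le_of_reach h1
    omega
  · by_contra hlt
    have := crit_rank_strictMono (x := x) (y := y) (κ := κ) (α := α) (r := r)
      (not_le.1 hlt) hk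
    have := rank_le_of_reach h2
    omega

theorem exists_dir_eq (i : Fin 3) (j : ℕ) : ∃ k, j ≤ k ∧ k < j + 3 ∧ dir k = i := by
  have hi := i.2
  refine ⟨j + (i + 3 - j % 3) % 3, by omega, by omega, ?_⟩
  ext
  simp only [dir]
  omega

/-- Three consecutive layers use all three directions, so each `α i` has a positive coefficient in
the displacement. -/
theorem disp_const_inj {α α' : Fin 3 → ℕ} {j j' : ℕ} (hj : j + 3 ≤ j')
    (h : disp (α ∘ dir) j j' = disp (α' ∘ dir) j j') : α = α' := by
  have key : ∀ (β : Fin 3 → ℕ) i, disp (β ∘ dir) j j' i =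
      ((Finset.Ico j j').filter fun k => dir k = i).card * β i := by
    intro β i
    simp only [disp, Function.comp]
    rw [← Finset.sum_filter, Finset.sum_congr rfl (g := fun _ => β i)
      (fun k hk => by rw [(Finset.mem_filter.1 hk).2]), Finset.sum_const, smul_eq_mul]
  ext i
  have hi := congrFun h i
  rw [key, key] at hi
  refine Nat.eq_of_mul_eq_mul_left (Finset.card_pos.2 ?_) hi
  obtain ⟨k, h1, h2, h3⟩ := exists_dir_eq i j
  exact ⟨k, Finset.mem_filter.2 ⟨Finset.mem_Ico.2 ⟨h1, by omega⟩, h3⟩⟩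

theorem crit_eq_crit_index {x' : Fin 3 → ℕ} {y' κ' : ℕ} {α' : Fin 3 → ℕ} {r' a a' : ℕ}
    (ha : a ≤ 3 * D + 2) (ha' : a' ≤ 3 * D + 2)
    (h : crit D x y κ α r a = crit D x' y' κ' α' r' a') : a = a' := by
  rcases ha.eq_or_lt with rfl | ha1 <;> rcases ha'.eq_or_lt with rfl | ha1'
  · rfl
  · rw [crit_last] at h
    rcases a' with _ | a'
    · simp [crit] at h
    · rw [crit_succ (by omega)] at h
      cases h
  · rw [crit_last] at h
    rcases a with _ | a
    · simp [crit] at h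
    · rw [crit_succ (by omega)] at h
      cases h
  · rw [← crit_rank (x := x) (y := y) (κ := κ) (α := α) (r := r) ha1, h, crit_rank ha1']

/-- A critical path is determined by any two of its vertices that are far apart. -/
theorem crit_determined (hD : 0 < D) {x' : Fin 3 → ℕ} {y' κ' : ℕ} {α' : Fin 3 → ℕ}
    {r' a b : ℕ} (hab : a + 5 ≤ b) (hb : b ≤ 3 * D + 2)
    (h1 : crit D x y κ α r a = crit D x' y' κ' α' r' a)
    (h2 : crit D x y κ α r b = crit D x' y' κ' α' r' b) : x = x' ∧ y = y' ∧ α = α' := by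
  -- Index `a` fixes position and height at a layer `j ≤ a`; index `b` fixes the position at a layer
  -- `j' ≥ b - 2`, the worst case being the rail vertex. Distance `5` thus leaves the three layers
  -- that `disp_const_inj` needs.
  have e1 : ∃ j ≤ a, D • x + disp (α ∘ dir) 0 j = D • x' + disp (α' ∘ dir) 0 j ∧
      y + cost (α ∘ dir) 0 j = y' + cost (α' ∘ dir) 0 j := by
    rcases a with _ | a
    · simp only [crit, Code.leaf.injEq] at h1
      exact ⟨0, le_rfl, by simp [disp_self, cost_self, h1]⟩
    · rw [crit_succ (by omega), crit_succ (by omega)] at h1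
      simp only [Code.mid.injEq] at h1
      exact ⟨a, by omega, h1.2⟩
  have e2 : ∃ j, b ≤ j + 2 ∧ D • x + disp (α ∘ dir) 0 j = D • x' + disp (α' ∘ dir) 0 j := by
    rcases hb.eq_or_lt with rfl | hb
    · rw [crit_last, crit_last] at h2
      simp only [Code.rail.injEq] at h2
      refine ⟨3 * D, le_rfl, ?_⟩
      rw [disp_const, disp_const, ← smul_add, ← smul_add, h2.1]
    · obtain ⟨b, rfl⟩ : ∃ b', b = b' + 1 := ⟨b - 1, by omega⟩
      rw [crit_succ (by omega), crit_succ (by omega)] at h2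
      simp only [Code.mid.injEq] at h2
      exact ⟨b, by omega, h2.2.1⟩
  obtain ⟨j, hj, hx, hy⟩ := e1
  obtain ⟨j', hj', hx'⟩ := e2
  rw [← disp_add (α ∘ dir) (Nat.zero_le j) (by omega : j ≤ j'),
    ← disp_add (α' ∘ dir) (Nat.zero_le j) (by omega : j ≤ j'), ← add_assoc, ← add_assoc,
    hx] at hx'
  obtain rfl := disp_const_inj (by omega) (add_left_cancel hx')
  refine ⟨?_, add_right_cancel hy, rfl⟩
  have := add_right_cancel hx
  ext i
  have hi := congrFun this i
  simp only [Pi.smul_apply, smul_eq_mul] at hi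
  exact Nat.eq_of_mul_eq_mul_left hD hi

end Crit

/-! ### Hard instances and the edges forced by certification -/

/-- The finite part of the universal graph that is present in every hard instance. -/
def InRegion (D Δ Y J K : ℕ) : Code → Prop
  | .leaf x y κ => (∀ i, x i < 2 * Δ) ∧ y < 2 * Y ∧ κ < K
  | .mid j x y => j ≤ 3 * D ∧ (∀ i, x i < 2 * Δ * D) ∧ y < 2 * Y
  | .rail g j i => (∀ i, Δ ≤ g i ∧ g i < 2 * Δ) ∧ j < J ∧ Y ≤ i ∧ i < 2 * Y
  | .pad _ => False

/-- `G` is an induced subgraph of the universal graph that contains the region, the vertex with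
code `w` being `vtx w`. -/
structure IsHardInstance {V : Type*} (D Δ A B Y J K : ℕ) (G : Digraph V) (lab : V → Code)
    (vtx : Code → V) : Prop where
  lab_injective : Function.Injective lab
  adj_iff : ∀ u v, G.Adj u v ↔ CodeAdj D Δ A B (lab u) (lab v)
  lab_vtx : ∀ w, InRegion D Δ Y J K w → lab (vtx w) = w

/-- The ends and the direction of a critical path are within range. -/
structure IsCritical (D Δ Y J K : ℕ) (x : Fin 3 → ℕ) (y κ : ℕ) (α : Fin 3 → ℕ) (r : ℕ) :
    Prop where
  dir_lt : ∀ i, α i < Δ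
  le_rail : ∀ i, Δ ≤ x i + α i
  rail_lt : ∀ i, x i + α i < 2 * Δ
  le_pos : Y ≤ y + D * ∑ i, α i ^ 2
  pos_lt : y + D * ∑ i, α i ^ 2 < 2 * Y
  index_lt : r < J
  copy_lt : κ < K

section Region

variable {D Δ A B Y J K : ℕ} {x : Fin 3 → ℕ} {y κ : ℕ} {α : Fin 3 → ℕ} {r : ℕ}

theorem disp_mono (a : ℕ → ℕ) {k l : ℕ} (h : k ≤ l) (i : Fin 3) :
    disp a 0 k i ≤ disp a 0 l i := by
  rw [← disp_add a (Nat.zero_le k) h]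
  simp

theorem cost_mono (a : ℕ → ℕ) {k l : ℕ} (h : k ≤ l) : cost a 0 k ≤ cost a 0 l := by
  rw [← cost_add a (Nat.zero_le k) h]
  simp

/-- Displacement and cost only grow along the walk, so the bounds at its end hold throughout. -/
theorem IsCritical.inRegion (h : IsCritical D Δ Y J K x y κ α r) (hD : 0 < D) {k : ℕ}
    (hk : k ≤ 3 * D + 2) : InRegion D Δ Y J K (crit D x y κ α r k) := by
  have hx := h.rail_lt
  have hy := h.pos_lt
  rcases k with _ | k
  · exact ⟨fun i => by have := hx i; omega, by omega, h.copy_lt⟩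
  · by_cases hk' : k ≤ 3 * D
    · rw [crit_succ hk']
      refine ⟨hk', fun i => ?_, ?_⟩
      · have h1 := disp_mono (α ∘ dir) hk' i
        rw [disp_const] at h1
        simp only [Pi.add_apply, Pi.smul_apply, smul_eq_mul] at h1 ⊢
        calc _ ≤ D * x i + D * α i := by omega
          _ = (x i + α i) * D := by ring
          _ < 2 * Δ * D := Nat.mul_lt_mul_of_pos_right (hx i) hD
      · have h1 := cost_mono (α ∘ dir) hk'
        rw [cost_const] at h1
        omega
    · obtain rfl : k = 3 * D + 1 := by omega
      rw [crit_last]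
      exact ⟨fun i => ⟨h.le_rail i, hx i⟩, h.index_lt, h.le_pos, hy⟩

end Region

namespace IsHardInstance

variable {V : Type*} {D Δ A B Y J K : ℕ} {G : Digraph V} {lab : V → Code} {vtx : Code → V}
  {x : Fin 3 → ℕ} {y κ : ℕ} {α : Fin 3 → ℕ} {r : ℕ}

theorem reach_lab (hG : IsHardInstance D Δ A B Y J K G lab vtx) {u v : V} (h : Reach G u v) :
    Reach (codeGraph D Δ A B) (lab u) (lab v) :=
  Relation.ReflTransGen.lift lab (fun u v huv => (hG.adj_iff u v).1 huv) _ _ h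

theorem isDAG (hG : IsHardInstance D Δ A B Y J K G lab vtx) : IsDAG G := by
  have : ∀ u v, Relation.TransGen G.Adj u v → (lab u).rank D < (lab v).rank D := by
    intro u v h
    induction h with
    | single h => exact CodeAdj.rank_lt ((hG.adj_iff _ _).1 h)
    | tail _ h ih => exact ih.trans (CodeAdj.rank_lt ((hG.adj_iff _ _).1 h))
  exact fun v h => (this v v h).false

/-- The critical path in the instance. -/
noncomputable def path (vtx : Code → V) (D : ℕ) (x : Fin 3 → ℕ) (y κ : ℕ) (α : Fin 3 → ℕ)
    (r k : ℕ) : V := vtx (crit D x y κ α r k)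

theorem lab_path (hG : IsHardInstance D Δ A B Y J K G lab vtx)
    (h : IsCritical D Δ Y J K x y κ α r) (hD : 0 < D) {k : ℕ} (hk : k ≤ 3 * D + 2) :
    lab (path vtx D x y κ α r k) = crit D x y κ α r k :=
  hG.lab_vtx _ (h.inRegion hD hk)

theorem reach_path (hG : IsHardInstance D Δ A B Y J K G lab vtx)
    (h : IsCritical D Δ Y J K x y κ α r) (hD : 0 < D) {k : ℕ} (hk : k ≤ 3 * D + 2) :
    Reach G (path vtx D x y κ α r 0) (path vtx D x y κ α r k) := by
  induction k with
  | zero => exact Relation.ReflTransGen.refl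
  | succ k ih =>
    refine (ih (by omega)).tail ?_
    rw [hG.adj_iff, hG.lab_path h hD (by omega), hG.lab_path h hD hk]
    exact crit_adj h.dir_lt (by omega)

/-- Shortcut edges respect reachability, so by `crit_between` every certificate of a pair on the
path is on the path, and strictly inside since there are no loops. This is the hypothesis of
`sub_le_card_longPairs`. -/
theorem path_le_card_longPairs (hG : IsHardInstance D Δ A B Y J K G lab vtx)
    (h : IsCritical D Δ Y J K x y κ α r) (hD : 0 < D) {H : Set (V × V)} (hH : IsShortcut G H)
    (hc : IsCertified G H)
    (hmem : (path vtx D x y κ α r 0, path vtx D x y κ α r (3 * D + 2)) ∈ H) :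
    3 * D + 2 ≤ 4 * (longPairs H (path vtx D x y κ α r) 0 (3 * D + 2)).card + 4 := by
  have hΔ : 0 < Δ := (Nat.zero_le _).trans_lt (h.dir_lt 0)
  have hreach : ∀ u v, (addEdges G H).Adj u v → Reach G u v := fun u v huv =>
    hH.reach_of_reach u v (Relation.ReflTransGen.single huv)
  have hirr : ∀ v, ¬ (addEdges G H).Adj v v := by
    rintro v (hv | hv)
    · exact (CodeAdj.rank_lt ((hG.adj_iff _ _).1 hv)).false
    · exact (hH.additional _ _ hv).1 rfl
  have := sub_le_card_longPairs hc (path vtx D x y κ α r) (3 * D + 2) ?_ ?_ (3 * D + 2) 0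
    (by omega) (by rw [zero_add]; exact Or.inr hmem)
  · rwa [zero_add] at this
  · intro a b hab hb
    rw [hG.adj_iff, hG.lab_path h hD (by omega), hG.lab_path h hD hb]
    exact crit_not_adj hab hb
  · intro a b w hab hb h1 h2
    have e1 := hG.reach_lab (hreach _ _ h1)
    have e2 := hG.reach_lab (hreach _ _ h2)
    rw [hG.lab_path h hD (by omega)] at e1
    rw [hG.lab_path h hD hb] at e2
    obtain ⟨k, hak, hkb, hw⟩ := crit_between hΔ h.dir_lt hab hb e1 e2
    rw [← hG.lab_path h hD (by omega : k ≤ 3 * D + 2)] at hw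
    obtain rfl := hG.lab_injective hw
    refine ⟨k, lt_of_le_of_ne hak ?_, lt_of_le_of_ne hkb ?_, rfl⟩
    · rintro rfl
      exact hirr _ h1
    · rintro rfl
      exact hirr _ h2

/-- A certified shortcut that contains the end pairs of many critical paths is large. -/
theorem card_mul_le_ncard [Finite V] (hG : IsHardInstance D Δ A B Y J K G lab vtx) (hD : 0 < D)
    {H : Set (V × V)} (hH : IsShortcut G H) (hc : IsCertified G H) {τ : Type*} (S : Finset τ)
    (x : τ → Fin 3 → ℕ) (y κ : τ → ℕ) (α : τ → Fin 3 → ℕ) (r : τ → ℕ)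
    (hcrit : ∀ t ∈ S, IsCritical D Δ Y J K (x t) (y t) (κ t) (α t) (r t))
    (hinj : ∀ t ∈ S, ∀ t' ∈ S, x t = x t' → y t = y t' → α t = α t' → t = t')
    (hmem : ∀ t ∈ S, (path vtx D (x t) (y t) (κ t) (α t) (r t) 0,
      path vtx D (x t) (y t) (κ t) (α t) (r t) (3 * D + 2)) ∈ H) :
    S.card * (3 * D - 2) ≤ 4 * H.ncard := by
  classical
  let p : τ → ℕ → V := fun t => path vtx D (x t) (y t) (κ t) (α t) (r t)
  have h1 : ∀ t ∈ S, 3 * D - 2 ≤ 4 * (longPairs H (p t) 0 (3 * D + 2)).card := by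
    intro t ht
    have := hG.path_le_card_longPairs (hcrit t ht) hD hH hc (hmem t ht)
    simp only [p]
    omega
  -- Long pairs of different critical paths are different edges of `H`. A pair need not reveal the
  -- copy `κ` or the rail index `r`, hence the form of `hinj`.
  have h2 : (S.sigma fun t => longPairs H (p t) 0 (3 * D + 2)).card ≤ H.ncard := by
    rw [← Set.ncard_coe_finset]
    refine Set.ncard_le_ncard_of_injOn (fun e => (p e.1 e.2.1, p e.1 e.2.2)) ?_ ?_
      (Set.toFinite H)
    · rintro ⟨t, e⟩ he
      simp only [Finset.coe_sigma, Set.mem_sigma_iff, Finset.mem_coe, mem_longPairs] at he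
      exact he.2.2.2.2
    · rintro ⟨t, a, b⟩ he ⟨t', a', b'⟩ he' heq
      simp only [Finset.coe_sigma, Set.mem_sigma_iff, Finset.mem_coe, mem_longPairs] at he he'
      simp only [Prod.mk.injEq] at heq
      obtain ⟨ha, hb⟩ := heq
      replace ha := congrArg lab ha
      replace hb := congrArg lab hb
      simp only [p] at ha hb
      rw [hG.lab_path (hcrit t he.1) hD (by omega),
        hG.lab_path (hcrit t' he'.1) hD (by omega)] at ha hb
      obtain rfl := crit_eq_crit_index (by omega) (by omega) ha
      obtain rfl := crit_eq_crit_index (by omega) (by omega) hb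
      obtain ⟨e1, e2, e3⟩ := crit_determined hD he.2.2.1 he.2.2.2.1 ha hb
      obtain rfl := hinj t he.1 t' he'.1 e1 e2 e3
      rfl
  rw [Finset.card_sigma] at h2
  calc S.card * (3 * D - 2) = ∑ t ∈ S, (3 * D - 2) := by simp
    _ ≤ ∑ t ∈ S, 4 * (longPairs H (p t) 0 (3 * D + 2)).card := Finset.sum_le_sum h1
    _ ≤ 4 * H.ncard := by rw [← Finset.mul_sum]; omega

end IsHardInstance

/-! ### Chains that meet a rail late -/

/-- `v` occurs in the list `γ` after some vertex of a rail. -/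
def IsLateOn {V : Type*} (lab : V → Code) (γ : List V) (v : V) : Prop :=
  ∃ as bs z, γ = as ++ v :: bs ∧ z ∈ as ∧ ∃ g j i, lab z = .rail g j i

theorem IsLateOn.mem {V : Type*} {lab : V → Code} {γ : List V} {v : V}
    (h : IsLateOn lab γ v) : v ∈ γ := by
  obtain ⟨as, bs, z, rfl, -⟩ := h
  simp

/-- Of two different rail vertices on a list, one occurs after the other and is therefore late. -/
theorem eq_of_not_isLateOn {V : Type*} {lab : V → Code} {γ : List V} {v w : V}
    (hv : v ∈ γ) (hw : w ∈ γ) (hvl : ¬ IsLateOn lab γ v) (hwl : ¬ IsLateOn lab γ w)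
    (hv' : ∃ g j i, lab v = .rail g j i) (hw' : ∃ g j i, lab w = .rail g j i) : v = w := by
  obtain ⟨as, bs, rfl⟩ := List.append_of_mem hv
  rw [List.mem_append, List.mem_cons] at hw
  rcases hw with hw | rfl | hw
  · exact absurd ⟨as, bs, w, rfl, hw, hw'⟩ hvl
  · rfl
  · obtain ⟨cs, ds, rfl⟩ := List.append_of_mem hw
    exact absurd ⟨as ++ v :: cs, ds, v, by simp, by simp, hv'⟩ hwl

namespace IsHardInstance

variable {V : Type*} {D Δ A B Y J K : ℕ} {G : Digraph V} {lab : V → Code} {vtx : Code → V}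

theorem reach_or_reach {γ : List V} (hγ : IsVertexChain G γ) {v w : V} (hv : v ∈ γ)
    (hw : w ∈ γ) : Reach G v w ∨ Reach G w v := by
  have hp := pairwise_reach hγ
  obtain ⟨as, bs, rfl⟩ := List.append_of_mem hv
  rw [List.pairwise_append, List.pairwise_cons] at hp
  rw [List.mem_append, List.mem_cons] at hw
  rcases hw with hw | rfl | hw
  · exact Or.inr (hp.2.2 _ hw _ (by simp))
  · exact Or.inl Relation.ReflTransGen.refl
  · exact Or.inl (hp.2.1.1 _ hw)

/-- If a vertex of a rail comes after another vertex of a rail on a chain, then it is the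
first vertex of this chain reachable from the start of each critical path ending in it. -/
theorem find_eq_some (hG : IsHardInstance D Δ A B Y J K G lab vtx) (hΔ : 0 < Δ)
    {x : Fin 3 → ℕ} {y κ : ℕ} {α : Fin 3 → ℕ} {r : ℕ} {γ : List V} (hγ : IsVertexChain G γ)
    {u v : V} (hu : lab u = .leaf x y κ) (hv : lab v = .rail (x + α) r (y + D * ∑ i, α i ^ 2))
    (huv : Reach G u v) (hl : IsLateOn lab γ v) (p : V → Bool)
    (hp : ∀ w, p w = true ↔ Reach G u w) : γ.find? p = some v := by
  obtain ⟨as, bs, z, rfl, hz, g, j, i, hzl⟩ := hl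
  rw [List.find?_eq_some_iff_append]
  refine ⟨(hp v).2 huv, as, bs, rfl, fun b hb => ?_⟩
  rw [Bool.not_eq_true', ← Bool.not_eq_true, hp]
  intro hub
  have hpw := pairwise_reach hγ
  have hnd := hγ.1
  have hlast : ∀ w ∈ as, Reach G w v ∧ w ≠ v := by
    intro w hw
    rw [List.pairwise_append] at hpw
    refine ⟨hpw.2.2 _ hw _ (by simp), ?_⟩
    rintro rfl
    exact (List.nodup_append.1 hnd).2.2 _ hw _ (by simp) rfl
  -- A rail vertex `w` that reaches `v` lies on the rail of `v`, at or before it. If `u` also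
  -- reaches `w`, `le_of_reach_rail` puts it no earlier than `v`, so it would be `v`.
  have hfirst : ∀ w ∈ as, Reach G u w → ¬ ∃ g j i, lab w = .rail g j i := by
    rintro w hw huw ⟨g, j, i, hwl⟩
    obtain ⟨hwv, hne⟩ := hlast w hw
    have e1 := hG.reach_lab hwv
    rw [hwl] at e1
    obtain ⟨i', hi', e2⟩ := reach_rail e1
    rw [hv] at e2
    obtain ⟨rfl, rfl, rfl⟩ := Code.rail.inj e2
    have e3 := hG.reach_lab huw
    rw [hwl, hu] at e3
    have := le_of_reach_rail hΔ e3
    obtain rfl := le_antisymm hi' this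
    exact hne (hG.lab_injective (hwl.trans hv.symm))
  have hchain : IsVertexChain G as :=
    ⟨(List.nodup_append.1 hnd).1, (List.isChain_append.1 hγ.2).1⟩
  -- A vertex reachable from `z` is on its rail, against `hfirst`; a vertex reaching `z` would make
  -- `z` reachable from `u`, again against `hfirst`.
  rcases reach_or_reach hchain hz hb with h | h
  · have e1 := hG.reach_lab h
    rw [hzl] at e1
    obtain ⟨i', -, e2⟩ := reach_rail e1
    exact hfirst b hb hub ⟨_, _, _, e2⟩
  · exact hfirst z hz (hub.trans h) ⟨_, _, _, hzl⟩

end IsHardInstance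

/-! ### Counting the targets that are met late -/

/-- The pairs `(g, i)` for which the vertices `rail g r i` belong to the region. -/
def targets (Δ Y : ℕ) : Finset ((Fin 3 → ℕ) × ℕ) :=
  Fintype.piFinset (fun _ => Finset.Ico Δ (2 * Δ)) ×ˢ Finset.Ico Y (2 * Y)

theorem mem_targets {Δ Y : ℕ} {t : (Fin 3 → ℕ) × ℕ} :
    t ∈ targets Δ Y ↔ (∀ i, Δ ≤ t.1 i ∧ t.1 i < 2 * Δ) ∧ Y ≤ t.2 ∧ t.2 < 2 * Y := by
  simp [targets]

theorem card_targets (Δ Y : ℕ) : (targets Δ Y).card = Δ ^ 3 * Y := by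
  simp [targets, two_mul]

section Counting

variable {V : Type*} {k : ℕ} (lab : V → Code) (vtx : Code → V) (c : Fin k → List V)

open Classical in
/-- The indices of the rails that meet some chain late at the target `t`. -/
noncomputable def goodRails (J : ℕ) (t : (Fin 3 → ℕ) × ℕ) : Finset ℕ :=
  (Finset.range J).filter fun r => ∃ i, IsLateOn lab (c i) (vtx (.rail t.1 r t.2))

open Classical in
/-- The chains that meet some rail late at the target `t`. -/
noncomputable def goodChains (J : ℕ) (t : (Fin 3 → ℕ) × ℕ) : Finset (Fin k) :=
  Finset.univ.filter fun i => ∃ r < J, IsLateOn lab (c i) (vtx (.rail t.1 r t.2))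

/-- The targets that are met late by at least half of their rails. -/
noncomputable def goodTargets (Δ Y J : ℕ) : Finset ((Fin 3 → ℕ) × ℕ) :=
  (targets Δ Y).filter fun t => J ≤ 2 * (goodRails lab vtx c J t).card

open Classical in
/-- The vertices of rails that are not met late by any chain. -/
noncomputable def badPairs (Δ Y J : ℕ) : Finset (((Fin 3 → ℕ) × ℕ) × ℕ) :=
  (targets Δ Y ×ˢ Finset.range J).filter
    fun e => ¬ ∃ i, IsLateOn lab (c i) (vtx (.rail e.1.1 e.2 e.1.2))

variable {lab vtx c}

/-- Markov's inequality: a target that is not good has more than `J / 2` bad rails, while on average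
a target has at most `J / 4`. -/
theorem card_targets_le {Δ Y J : ℕ} (hJ : 0 < J)
    (h : 4 * (badPairs lab vtx c Δ Y J).card ≤ Δ ^ 3 * Y * J) :
    Δ ^ 3 * Y ≤ 2 * (goodTargets lab vtx c Δ Y J).card := by
  classical
  have h1 : (badPairs lab vtx c Δ Y J).card =
      ∑ t ∈ targets Δ Y, (J - (goodRails lab vtx c J t).card) := by
    rw [Finset.card_eq_sum_card_fiberwise (s := badPairs lab vtx c Δ Y J) (f := Prod.fst)
      (t := targets Δ Y)
      (fun e he => (Finset.mem_product.1 (Finset.mem_filter.1 he).1).1)]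
    refine Finset.sum_congr rfl fun t ht => ?_
    have : (Finset.range J \ goodRails lab vtx c J t).card =
        J - (goodRails lab vtx c J t).card := by
      have hs : goodRails lab vtx c J t ⊆ Finset.range J := Finset.filter_subset _ _
      rw [Finset.card_sdiff_of_subset hs, Finset.card_range]
    rw [← this]
    refine Finset.card_bij (fun e _ => e.2) ?_ ?_ ?_
    · rintro ⟨t', r⟩ he
      simp only [badPairs, Finset.mem_filter, Finset.mem_product, Finset.mem_range] at he
      obtain ⟨⟨⟨-, hr⟩, hbad⟩, rfl⟩ := he
      simp only [goodRails, Finset.mem_sdiff, Finset.mem_filter, Finset.mem_range]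
      exact ⟨hr, fun h => hbad h.2⟩
    · rintro ⟨t', r⟩ he ⟨t'', r'⟩ he' hrr
      obtain rfl := (Finset.mem_filter.1 he).2
      obtain h := (Finset.mem_filter.1 he').2
      exact Prod.ext h.symm hrr
    · intro r hr
      simp only [goodRails, Finset.mem_sdiff, Finset.mem_filter, Finset.mem_range] at hr
      refine ⟨(t, r), ?_, rfl⟩
      simp only [badPairs, Finset.mem_filter, Finset.mem_product, Finset.mem_range]
      exact ⟨⟨⟨ht, hr.1⟩, fun h => hr.2 ⟨hr.1, h⟩⟩, trivial⟩
  have h2 : ∑ t ∈ (targets Δ Y).filter (fun t => ¬ J ≤ 2 * (goodRails lab vtx c J t).card), J ≤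
      2 * (badPairs lab vtx c Δ Y J).card := by
    rw [h1, Finset.mul_sum]
    refine (Finset.sum_le_sum fun t ht => ?_).trans
      (Finset.sum_le_sum_of_subset (Finset.filter_subset _ _))
    have := (Finset.mem_filter.1 ht).2
    omega
  rw [Finset.sum_const, smul_eq_mul] at h2
  have h3 := Finset.card_filter_add_card_filter_not (s := targets Δ Y)
    (fun t => J ≤ 2 * (goodRails lab vtx c J t).card)
  rw [card_targets] at h3
  change (goodTargets lab vtx c Δ Y J).card + _ = _ at h3
  set b := ((targets Δ Y).filter fun t => ¬ J ≤ 2 * (goodRails lab vtx c J t).card).card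
  have h4 : (2 * b) * J ≤ (Δ ^ 3 * Y) * J := by nlinarith
  have := Nat.le_of_mul_le_mul_right h4 hJ
  omega

end Counting

namespace IsHardInstance

variable {V : Type*} {D Δ A B Y J K : ℕ} {G : Digraph V} {lab : V → Code} {vtx : Code → V}
  {k : ℕ} {c : Fin k → List V}

theorem lab_rail (hG : IsHardInstance D Δ A B Y J K G lab vtx) {t : (Fin 3 → ℕ) × ℕ}
    (ht : t ∈ targets Δ Y) {r : ℕ} (hr : r < J) :
    lab (vtx (.rail t.1 r t.2)) = .rail t.1 r t.2 := by
  rw [mem_targets] at ht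
  exact hG.lab_vtx _ ⟨ht.1, hr, ht.2⟩

/-- The part of a rail inside the region is itself a path of `G`, so the covering condition applies
to it. -/
theorem card_uncovered_le (hG : IsHardInstance D Δ A B Y J K G lab vtx) {U : ℕ}
    (hU : ∀ P : List V, P.Nodup → P.IsChain G.Adj → {v | v ∈ P ∧ ∀ i, v ∉ c i}.ncard ≤ U)
    (g : Fin 3 → ℕ) (hg : ∀ i, Δ ≤ g i ∧ g i < 2 * Δ) {r : ℕ} (hr : r < J)
    (S : Finset ℕ) (hS : ∀ i ∈ S, Y ≤ i ∧ i < 2 * Y ∧ ∀ l, vtx (.rail g r i) ∉ c l) :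
    S.card ≤ U := by
  have hlab : ∀ i, Y ≤ i → i < 2 * Y → lab (vtx (.rail g r i)) = .rail g r i :=
    fun i h1 h2 => hG.lab_vtx _ ⟨hg, hr, h1, h2⟩
  let P : List V := (List.range' Y Y).map fun i => vtx (.rail g r i)
  have hmem : ∀ i ∈ List.range' Y Y, Y ≤ i ∧ i < 2 * Y := by
    intro i hi
    rw [List.mem_range'_1] at hi
    omega
  have hnd : P.Nodup := by
    refine List.Nodup.map_on ?_ List.nodup_range'
    intro i hi j hj hij
    have := congrArg lab hij
    rw [hlab i (hmem i hi).1 (hmem i hi).2, hlab j (hmem j hj).1 (hmem j hj).2] at this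
    exact (Code.rail.inj this).2.2
  have hch : P.IsChain G.Adj := by
    rw [List.isChain_map]
    rw [List.isChain_iff_getElem]
    intro i hi
    rw [List.length_range'] at hi
    simp only [List.getElem_range']
    rw [hG.adj_iff, hlab _ (by omega) (by omega), hlab _ (by omega) (by omega)]
    have := CodeAdj.next (D := D) (Δ := Δ) (A := A) (B := B) g r (Y + 1 * i)
    rwa [show Y + 1 * (i + 1) = Y + 1 * i + 1 by ring]
  refine le_trans ?_ (hU P hnd hch)
  rw [← Set.ncard_coe_finset]
  refine Set.ncard_le_ncard_of_injOn (fun i => vtx (.rail g r i)) ?_ ?_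
    ((List.finite_toSet P).subset fun v hv => hv.1)
  · intro i hi
    obtain ⟨h1, h2, h3⟩ := hS i hi
    refine ⟨List.mem_map.2 ⟨i, ?_, rfl⟩, h3⟩
    rw [List.mem_range'_1]
    omega
  · intro i hi j hj hij
    have := congrArg lab hij
    dsimp only at this
    rw [hlab i (hS i hi).1 (hS i hi).2.1, hlab j (hS j hj).1 (hS j hj).2.1] at this
    exact (Code.rail.inj this).2.2

/-- A bad vertex is either on no chain, at most `U` per rail, or on a chain without being late, at
most one per chain by `eq_of_not_isLateOn`. -/
theorem card_badPairs_le (hG : IsHardInstance D Δ A B Y J K G lab vtx) {U : ℕ}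
    (hU : ∀ P : List V, P.Nodup → P.IsChain G.Adj → {v | v ∈ P ∧ ∀ i, v ∉ c i}.ncard ≤ U) :
    (badPairs lab vtx c Δ Y J).card ≤ Δ ^ 3 * J * U + k := by
  classical
  let pr : ((Fin 3 → ℕ) × ℕ) × ℕ → V := fun e => vtx (.rail e.1.1 e.2 e.1.2)
  have hlab : ∀ e ∈ badPairs lab vtx c Δ Y J, lab (pr e) = .rail e.1.1 e.2 e.1.2 := by
    intro e he
    have := Finset.mem_product.1 (Finset.mem_filter.1 he).1
    exact hG.lab_rail this.1 (Finset.mem_range.1 this.2)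
  rw [← Finset.card_filter_add_card_filter_not (s := badPairs lab vtx c Δ Y J)
    (fun e => ∀ l, pr e ∉ c l)]
  refine Nat.add_le_add ?_ ?_
  · have hmaps : ∀ e ∈ (badPairs lab vtx c Δ Y J).filter (fun e => ∀ l, pr e ∉ c l),
        (e.1.1, e.2) ∈ Fintype.piFinset (fun _ : Fin 3 => Finset.Ico Δ (2 * Δ)) ×ˢ
          Finset.range J := by
      intro e he
      have := Finset.mem_product.1 (Finset.mem_filter.1 (Finset.mem_filter.1 he).1).1
      exact Finset.mem_product.2 ⟨(Finset.mem_product.1 this.1).1, this.2⟩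
    have := Finset.card_le_mul_card_image_of_maps_to hmaps U ?_
    · refine this.trans (le_of_eq ?_)
      simp [two_mul]
      ring
    · rintro ⟨g, r⟩ hgr
      rw [Finset.mem_product, Fintype.mem_piFinset, Finset.mem_range] at hgr
      refine le_trans ?_ (hG.card_uncovered_le hU g (fun i => Finset.mem_Ico.1 (hgr.1 i)) hgr.2
        ((((badPairs lab vtx c Δ Y J).filter (fun e => ∀ l, pr e ∉ c l)).filter
          (fun e => (e.1.1, e.2) = (g, r))).image fun e => e.1.2) ?_)
      · rw [Finset.card_image_of_injOn]
        rintro ⟨⟨g1, i1⟩, r1⟩ h1 ⟨⟨g2, i2⟩, r2⟩ h2 h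
        have e1 := (Finset.mem_filter.1 h1).2
        have e2 := (Finset.mem_filter.1 h2).2
        simp only [Prod.mk.injEq] at e1 e2 h ⊢
        exact ⟨⟨e1.1.trans e2.1.symm, h⟩, e1.2.trans e2.2.symm⟩
      · intro i hi
        obtain ⟨⟨⟨g1, i1⟩, r1⟩, h1, rfl⟩ := Finset.mem_image.1 hi
        rw [Finset.mem_filter, Finset.mem_filter] at h1
        obtain ⟨⟨h1, h2⟩, h3⟩ := h1
        have := Finset.mem_product.1 (Finset.mem_filter.1 h1).1
        have ht := mem_targets.1 this.1
        simp only [Prod.mk.injEq] at h3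
        obtain ⟨rfl, rfl⟩ := h3
        exact ⟨ht.2.1, ht.2.2, h2⟩
  · have hex : ∀ e : {e // e ∈ (badPairs lab vtx c Δ Y J).filter (fun e => ¬ ∀ l, pr e ∉ c l)},
        ∃ l, pr e.1 ∈ c l := by
      intro e
      have := (Finset.mem_filter.1 e.2).2
      push Not at this
      exact this
    choose f hf using hex
    have hinj : Function.Injective f := by
      intro e e' hee
      have hb := (Finset.mem_filter.1 e.2).1
      have hb' := (Finset.mem_filter.1 e'.2).1
      have h1 := (Finset.mem_filter.1 hb).2
      have h2 := (Finset.mem_filter.1 hb').2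
      have hm' := hf e'
      rw [← hee] at hm'
      have := congrArg lab (eq_of_not_isLateOn (lab := lab) (hf e) hm' (fun h => h1 ⟨_, h⟩)
        (fun h => h2 ⟨_, h⟩) ⟨_, _, _, hlab _ hb⟩ ⟨_, _, _, hlab _ hb'⟩)
      rw [hlab _ hb, hlab _ hb'] at this
      obtain ⟨h3, h4, h5⟩ := Code.rail.inj this
      exact Subtype.ext (Prod.ext (Prod.ext h3 h5) h4)
    have := Fintype.card_le_of_injective f hinj
    simpa using this

/-- Vertices of different rails are incomparable, so no chain serves two rails. -/
theorem card_goodRails_le (hG : IsHardInstance D Δ A B Y J K G lab vtx)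
    (hc : ∀ i, IsVertexChain G (c i)) {t : (Fin 3 → ℕ) × ℕ} (ht : t ∈ targets Δ Y) :
    (goodRails lab vtx c J t).card ≤ (goodChains lab vtx c J t).card := by
  classical
  have hex : ∀ r ∈ goodRails lab vtx c J t, ∃ i, IsLateOn lab (c i) (vtx (.rail t.1 r t.2)) :=
    fun r hr => (Finset.mem_filter.1 hr).2
  rcases (goodRails lab vtx c J t).eq_empty_or_nonempty with hemp | ⟨r₀, hr₀⟩
  · simp [hemp]
  have : Nonempty (Fin k) := (hex r₀ hr₀).nonempty
  choose! f hf using hex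
  refine Finset.card_le_card_of_injOn f ?_ ?_
  · intro r hr
    exact Finset.mem_filter.2 ⟨Finset.mem_univ _, r,
      Finset.mem_range.1 (Finset.mem_filter.1 hr).1, hf r hr⟩
  · intro r hr r' hr' heq
    have h1 := (hf r hr).mem
    have h2 := (hf r' hr').mem
    rw [← heq] at h2
    have e1 := hG.lab_rail ht (Finset.mem_range.1 (Finset.mem_filter.1 hr).1)
    have e2 := hG.lab_rail ht (Finset.mem_range.1 (Finset.mem_filter.1 hr').1)
    rcases reach_or_reach (hc (f r)) h1 h2 with h | h
    · have := hG.reach_lab h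
      rw [e1, e2] at this
      obtain ⟨i', -, h⟩ := reach_rail this
      exact (Code.rail.inj h).2.1.symm
    · have := hG.reach_lab h
      rw [e1, e2] at this
      obtain ⟨i', -, h⟩ := reach_rail this
      exact (Code.rail.inj h).2.1

theorem sum_sq_le {α : Fin 3 → ℕ} (hα : ∀ i, α i < Δ) : ∑ i, α i ^ 2 ≤ 3 * Δ ^ 2 := by
  calc ∑ i, α i ^ 2 ≤ ∑ _i : Fin 3, Δ ^ 2 :=
        Finset.sum_le_sum fun i _ => Nat.pow_le_pow_left (hα i).le 2
    _ = 3 * Δ ^ 2 := by simp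

/-- If every source and every good target is sampled, then the certification complexity of the
Kogan–Parter shortcut is large. -/
theorem le_certificationComplexity [Finite V] (hG : IsHardInstance D Δ A B Y J K G lab vtx)
    (hD : 0 < D) (hY : 3 * D * Δ ^ 2 ≤ Y) (hc : ∀ i, IsVertexChain G (c i))
    {H₁ : Set (V × V)} (hH₁ : IsShortcut G H₁) {S : Set V} {T : Set (Fin k)}
    (hS : ∀ x y, (∀ i, x i < 2 * Δ) → y < 2 * Y → ∃ κ < K, vtx (.leaf x y κ) ∈ S)
    (hT : ∀ t ∈ goodTargets lab vtx c Δ Y J, ∃ i ∈ goodChains lab vtx c J t, i ∈ T) :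
    (goodTargets lab vtx c Δ Y J).card * Δ ^ 3 * (3 * D - 2) ≤
      4 * certificationComplexity G (koganParter G c H₁ S T) := by
  classical
  obtain ⟨H, hH, hcert, hsub, hcard⟩ :=
    certificationComplexity_attained (isShortcut_koganParter c hH₁ S T)
  rw [← hcard]
  rcases (goodTargets lab vtx c Δ Y J).eq_empty_or_nonempty with hemp | ⟨t₀, ht₀⟩
  · simp [hemp]
  have : Nonempty (Fin k) := (hT t₀ ht₀).nonempty
  choose! κ hκK hκS using hS
  choose! l hl hlT using hT
  have hr : ∀ t ∈ goodTargets lab vtx c Δ Y J,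
      ∃ r < J, IsLateOn lab (c (l t)) (vtx (.rail t.1 r t.2)) := fun t ht =>
    (Finset.mem_filter.1 (hl t ht)).2
  choose! r hrJ hlate using hr
  -- A critical path is indexed by its target and its direction; `src` and `ht` recover the starting
  -- point and height. The truncated subtractions are exact because target coordinates are at least
  -- `Δ` and positions at least `Y ≥ 3 * D * Δ ^ 2`.
  let src : ((Fin 3 → ℕ) × ℕ) × (Fin 3 → ℕ) → Fin 3 → ℕ := fun e => e.1.1 - e.2
  let ht : ((Fin 3 → ℕ) × ℕ) × (Fin 3 → ℕ) → ℕ := fun e => e.1.2 - D * ∑ i, e.2 i ^ 2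
  let Θ := goodTargets lab vtx c Δ Y J ×ˢ Fintype.piFinset fun _ : Fin 3 => Finset.range Δ
  have hback : ∀ e ∈ Θ, e.1 ∈ targets Δ Y ∧ (∀ i, e.2 i < Δ) ∧ src e + e.2 = e.1.1 ∧
      ht e + D * ∑ i, e.2 i ^ 2 = e.1.2 := by
    intro e he
    rw [Finset.mem_product, Fintype.mem_piFinset] at he
    have h1 := (Finset.mem_filter.1 he.1).1
    have h2 : ∀ i, e.2 i < Δ := fun i => Finset.mem_range.1 (he.2 i)
    have h3 := mem_targets.1 h1
    refine ⟨h1, h2, ?_, ?_⟩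
    · ext i
      have := h2 i
      have := (h3.1 i).1
      simp only [src, Pi.add_apply, Pi.sub_apply]
      omega
    · have : D * ∑ i, e.2 i ^ 2 ≤ D * (3 * Δ ^ 2) := Nat.mul_le_mul_left _ (sum_sq_le h2)
      have h4 : D * (3 * Δ ^ 2) = 3 * D * Δ ^ 2 := by ring
      simp only [ht]
      omega
  have hcrit : ∀ e ∈ Θ, IsCritical D Δ Y J K (src e) (ht e) (κ (src e) (ht e)) e.2 (r e.1) := by
    intro e he
    obtain ⟨h1, h2, h3, h4⟩ := hback e he
    have h5 := mem_targets.1 h1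
    have h6 : ∀ i, src e i + e.2 i = e.1.1 i := fun i => congrFun h3 i
    refine ⟨h2, fun i => ?_, fun i => ?_, ?_, ?_, ?_, ?_⟩
    · rw [h6]; exact (h5.1 i).1
    · rw [h6]; exact (h5.1 i).2
    · rw [h4]; exact h5.2.1
    · rw [h4]; exact h5.2.2
    · exact hrJ _ (Finset.mem_product.1 he).1
    · refine hκK _ _ (fun i => ?_) ?_
      · have := h6 i
        have := (h5.1 i).2
        omega
      · omega
  have key := hG.card_mul_le_ncard hD hH hcert Θ src ht (fun e => κ (src e) (ht e)) (fun e => e.2)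
    (fun e => r e.1) hcrit ?_ ?_
  · simpa [Θ] using key
  · intro e he e' he' h1 h2 h3
    obtain ⟨-, -, h4, h5⟩ := hback e he
    obtain ⟨-, -, h4', h5'⟩ := hback e' he'
    rw [h1, h3, h4'] at h4
    rw [h2, h3, h5'] at h5
    exact Prod.ext (Prod.ext h4.symm h5.symm) h3
  · intro e he
    obtain ⟨h1, h2, h3, h4⟩ := hback e he
    have hcr := hcrit e he
    have heT := (Finset.mem_product.1 he).1
    apply hsub
    right
    have hlab0 := hG.lab_path hcr hD (Nat.zero_le _)
    have hlab1 := hG.lab_path hcr hD le_rfl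
    have hreach := hG.reach_path hcr hD le_rfl
    have hend : path vtx D (src e) (ht e) (κ (src e) (ht e)) e.2 (r e.1) (3 * D + 2) =
        vtx (.rail e.1.1 (r e.1) e.1.2) := by
      rw [path, crit_last, h3, h4]
    refine ⟨?_, ⟨l e.1, hlT _ heT, ?_⟩, ?_, ?_⟩
    · refine hκS _ _ (fun i => ?_) ?_
      · have := hcr.rail_lt i
        omega
      · have := hcr.pos_lt
        omega
    · refine hG.find_eq_some ((Nat.zero_le _).trans_lt (h2 0)) (hc _) hlab0
        (hlab1.trans crit_last) hreach ?_ _ (fun w => by simp)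
      rw [hend]
      exact hlate _ heT
    · intro h
      have := congrArg lab h
      dsimp only at this
      rw [hlab0, hlab1] at this
      have := crit_eq_crit_index (by omega) le_rfl this
      omega
    · dsimp only
      rw [hG.adj_iff, hlab0, hlab1]
      exact crit_not_adj (by omega) le_rfl

end IsHardInstance

/-! ### The random sample: a union bound over missed families -/

section Sampling

/-- The probability that a Bernoulli random set avoids a given finite set. -/
theorem setBernoulli_real_avoid {ι : Type*} (p : unitInterval) (F : Finset ι) :
    (setBernoulli (Set.univ : Set ι) p).real {s | ∀ i ∈ F, i ∉ s} = (1 - (p : ℝ)) ^ F.card := by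
  have hset : ((fun f : ι → Prop => {i | f i}) ⁻¹' {s : Set ι | ∀ i ∈ F, i ∉ s}) =
      Set.pi (F : Set ι) fun _ => {False} := by
    ext f
    simp
  rw [measureReal_def, setBernoulli_apply', hset, Measure.infinitePi_pi _ (fun i _ => by simp)]
  simp

instance (V : Type*) (k : ℕ) (p q : unitInterval) : IsProbabilityMeasure (sampleLaw V k p q) := by
  unfold sampleLaw
  infer_instance

/-- The probability that all the sets in two families are hit by the sample. -/
theorem one_sub_le_sampleLaw {V : Type*} {k : ℕ} {p q : unitInterval} {σ τ : Type*}
    (I : Finset σ) (F : σ → Finset V) (I' : Finset τ) (F' : τ → Finset (Fin k)) {a b : ℕ}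
    (hF : ∀ t ∈ I, a ≤ (F t).card) (hF' : ∀ t ∈ I', b ≤ (F' t).card)
    (S : Set (Set V × Set (Fin k)))
    (hS : ∀ s, (∀ t ∈ I, ∃ v ∈ F t, v ∈ s.1) → (∀ t ∈ I', ∃ i ∈ F' t, i ∈ s.2) → s ∈ S) :
    1 - (I.card * (1 - (p : ℝ)) ^ a + I'.card * (1 - (q : ℝ)) ^ b) ≤
      (sampleLaw V k p q).real S := by
  let μ := sampleLaw V k p q
  have hp0 : 0 ≤ 1 - (p : ℝ) := sub_nonneg.2 p.2.2
  have hp1 : 1 - (p : ℝ) ≤ 1 := sub_le_self _ p.2.1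
  have hq0 : 0 ≤ 1 - (q : ℝ) := sub_nonneg.2 q.2.2
  have hq1 : 1 - (q : ℝ) ≤ 1 := sub_le_self _ q.2.1
  let E : σ → Set (Set V × Set (Fin k)) := fun t => {s | ∀ v ∈ F t, v ∉ s} ×ˢ Set.univ
  let E' : τ → Set (Set V × Set (Fin k)) := fun t => Set.univ ×ˢ {s | ∀ i ∈ F' t, i ∉ s}
  have hE : ∀ t ∈ I, μ.real (E t) ≤ (1 - (p : ℝ)) ^ a := by
    intro t ht
    simp only [μ, E, sampleLaw]
    rw [measureReal_prod_prod, setBernoulli_real_avoid, probReal_univ, mul_one]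
    exact pow_le_pow_of_le_one hp0 hp1 (hF t ht)
  have hE' : ∀ t ∈ I', μ.real (E' t) ≤ (1 - (q : ℝ)) ^ b := by
    intro t ht
    simp only [μ, E', sampleLaw]
    rw [measureReal_prod_prod, setBernoulli_real_avoid, probReal_univ, one_mul]
    exact pow_le_pow_of_le_one hq0 hq1 (hF' t ht)
  have hcover : Set.univ ⊆ S ∪ ((⋃ t ∈ I, E t) ∪ ⋃ t ∈ I', E' t) := by
    rintro s -
    by_cases h1 : ∀ t ∈ I, ∃ v ∈ F t, v ∈ s.1
    · by_cases h2 : ∀ t ∈ I', ∃ i ∈ F' t, i ∈ s.2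
      · exact Or.inl (hS s h1 h2)
      · push Not at h2
        obtain ⟨t, ht, h⟩ := h2
        exact Or.inr (Or.inr (Set.mem_biUnion ht ⟨trivial, h⟩))
    · push Not at h1
      obtain ⟨t, ht, h⟩ := h1
      exact Or.inr (Or.inl (Set.mem_biUnion ht ⟨h, trivial⟩))
  have h1 : μ.real Set.univ ≤ μ.real S + (μ.real (⋃ t ∈ I, E t) + μ.real (⋃ t ∈ I', E' t)) :=
    (measureReal_mono hcover).trans ((measureReal_union_le _ _).trans
      (add_le_add_right (measureReal_union_le _ _) _))
  have h2 : μ.real (⋃ t ∈ I, E t) ≤ I.card * (1 - (p : ℝ)) ^ a :=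
    (measureReal_biUnion_finset_le _ _).trans
      ((Finset.sum_le_sum hE).trans (by simp))
  have h3 : μ.real (⋃ t ∈ I', E' t) ≤ I'.card * (1 - (q : ℝ)) ^ b :=
    (measureReal_biUnion_finset_le _ _).trans
      ((Finset.sum_le_sum hE').trans (by simp))
  rw [probReal_univ] at h1
  change _ ≤ μ.real S
  linarith

end Sampling

namespace IsHardInstance

variable {V : Type*} {D Δ A B Y J K : ℕ} {G : Digraph V} {lab : V → Code} {vtx : Code → V}
  {k : ℕ} {c : Fin k → List V}

/-- The Kogan–Parter shortcut of a hard instance has large certification complexity with high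
probability. -/
theorem one_sub_le_prob [Finite V] (hG : IsHardInstance D Δ A B Y J K G lab vtx)
    (hD : 0 < D) (hJ : 0 < J) (hY : 3 * D * Δ ^ 2 ≤ Y) (hc : ∀ i, IsVertexChain G (c i)) {U : ℕ}
    (hU : ∀ P : List V, P.Nodup → P.IsChain G.Adj → {v | v ∈ P ∧ ∀ i, v ∉ c i}.ncard ≤ U)
    (hbad : 4 * (Δ ^ 3 * J * U + k) ≤ Δ ^ 3 * Y * J)
    {H₁ : Set (V × V)} (hH₁ : IsShortcut G H₁) (p q : unitInterval) :
    1 - (16 * Δ ^ 3 * Y * (1 - (p : ℝ)) ^ K + Δ ^ 3 * Y * (1 - (q : ℝ)) ^ (J / 2)) ≤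
      (sampleLaw V k p q).real {s | Δ ^ 3 * Y * Δ ^ 3 * (3 * D - 2) ≤
        8 * certificationComplexity G (koganParter G c H₁ s.1 s.2)} := by
  classical
  have hgood := card_targets_le hJ ((Nat.mul_le_mul_left 4 (hG.card_badPairs_le hU)).trans hbad)
  have hsub : goodTargets lab vtx c Δ Y J ⊆ targets Δ Y := Finset.filter_subset _ _
  let I : Finset ((Fin 3 → ℕ) × ℕ) :=
    Fintype.piFinset (fun _ => Finset.range (2 * Δ)) ×ˢ Finset.range (2 * Y)
  have hI : I.card = 16 * Δ ^ 3 * Y := by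
    simp only [I, Finset.card_product, Fintype.card_piFinset_const, Finset.card_range]
    ring
  have hinj : ∀ e ∈ I, Set.InjOn (fun κ => vtx (.leaf e.1 e.2 κ)) (Finset.range K) := by
    intro e he κ hκ κ' hκ' h
    simp only [I, Finset.mem_product, Fintype.mem_piFinset, Finset.mem_range] at he
    have h1 := Finset.mem_range.1 (Finset.mem_coe.1 hκ)
    have h2 := Finset.mem_range.1 (Finset.mem_coe.1 hκ')
    have := congrArg lab h
    dsimp only at this
    rw [hG.lab_vtx (.leaf e.1 e.2 κ) ⟨he.1, he.2, h1⟩,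
      hG.lab_vtx (.leaf e.1 e.2 κ') ⟨he.1, he.2, h2⟩] at this
    exact (Code.leaf.inj this).2.2
  have key := one_sub_le_sampleLaw (p := p) (q := q) I
    (fun e => (Finset.range K).image fun κ => vtx (.leaf e.1 e.2 κ))
    (goodTargets lab vtx c Δ Y J) (goodChains lab vtx c J) (a := K) (b := J / 2) ?_ ?_
    {s | Δ ^ 3 * Y * Δ ^ 3 * (3 * D - 2) ≤
        8 * certificationComplexity G (koganParter G c H₁ s.1 s.2)} ?_
  · refine le_trans ?_ key
    have h1 : ((goodTargets lab vtx c Δ Y J).card : ℝ) ≤ Δ ^ 3 * Y := by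
      have := Finset.card_le_card hsub
      rw [card_targets] at this
      exact_mod_cast this
    have h2 : 0 ≤ (1 - (q : ℝ)) ^ (J / 2) := pow_nonneg (sub_nonneg.2 q.2.2) _
    have h3 := mul_le_mul_of_nonneg_right h1 h2
    rw [hI]
    push_cast
    linarith
  · intro e he
    rw [Finset.card_image_of_injOn (hinj e he), Finset.card_range]
  · intro t ht
    have h1 := (Finset.mem_filter.1 ht).2
    have h2 := hG.card_goodRails_le hc (hsub ht)
    omega
  · intro s hs1 hs2
    have := hG.le_certificationComplexity hD hY hc hH₁ (S := s.1) (T := s.2) ?_ hs2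
    · have h3 := Nat.mul_le_mul_right (Δ ^ 3 * (3 * D - 2)) hgood
      simp only [Set.mem_ofPred_eq]
      calc Δ ^ 3 * Y * Δ ^ 3 * (3 * D - 2) = Δ ^ 3 * Y * (Δ ^ 3 * (3 * D - 2)) := by ring
        _ ≤ 2 * (goodTargets lab vtx c Δ Y J).card * (Δ ^ 3 * (3 * D - 2)) := h3
        _ = 2 * ((goodTargets lab vtx c Δ Y J).card * Δ ^ 3 * (3 * D - 2)) := by ring
        _ ≤ _ := by omega
    · intro x y hx hy
      obtain ⟨v, hv, hvs⟩ := hs1 (x, y) (by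
        simp only [I, Finset.mem_product, Fintype.mem_piFinset, Finset.mem_range]
        exact ⟨hx, hy⟩)
      obtain ⟨κ, hκ, rfl⟩ := Finset.mem_image.1 hv
      exact ⟨κ, Finset.mem_range.1 hκ, hvs⟩

end IsHardInstance

/-! ### Existence and edge count of hard instances -/

section Construction

/-- The parameters of the sources of the region. -/
def leafBox (Δ Y K : ℕ) : Finset ((Fin 3 → ℕ) × ℕ × ℕ) :=
  Fintype.piFinset (fun _ => Finset.range (2 * Δ)) ×ˢ Finset.range (2 * Y) ×ˢ Finset.range K

/-- The parameters of the vertices of the layered graph of the region. -/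
def midBox (D Δ Y : ℕ) : Finset (ℕ × (Fin 3 → ℕ) × ℕ) :=
  Finset.range (3 * D + 1) ×ˢ Fintype.piFinset (fun _ => Finset.range (2 * Δ * D)) ×ˢ
    Finset.range (2 * Y)

/-- The number of vertices of the layered graph of the region. -/
def midCard (D Δ Y : ℕ) : ℕ := (3 * D + 1) * ((2 * Δ * D) ^ 3 * (2 * Y))

theorem card_midBox (D Δ Y : ℕ) : (midBox D Δ Y).card = midCard D Δ Y := by
  simp [midBox, midCard]

open Classical in
/-- The region as a finite set. -/
noncomputable def region (D Δ Y J K : ℕ) : Finset Code :=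
  (leafBox Δ Y K).image (fun e => .leaf e.1 e.2.1 e.2.2) ∪
    ((midBox D Δ Y).image (fun e => .mid e.1 e.2.1 e.2.2) ∪
      (targets Δ Y ×ˢ Finset.range J).image fun e => .rail e.1.1 e.2 e.1.2)

/-- The number of vertices of the region is at most `regionCard`. -/
def regionCard (D Δ Y J K : ℕ) : ℕ :=
  (2 * Δ) ^ 3 * (2 * Y * K) + (midCard D Δ Y + Δ ^ 3 * Y * J)

theorem card_region_le (D Δ Y J K : ℕ) : (region D Δ Y J K).card ≤ regionCard D Δ Y J K := by
  classical
  refine (Finset.card_union_le _ _).trans (Nat.add_le_add ?_ ((Finset.card_union_le _ _).trans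
    (Nat.add_le_add ?_ ?_)))
  · refine Finset.card_image_le.trans (le_of_eq ?_)
    simp [leafBox]
  · exact Finset.card_image_le.trans (card_midBox D Δ Y).le
  · refine Finset.card_image_le.trans (le_of_eq ?_)
    rw [Finset.card_product, card_targets, Finset.card_range]

theorem mem_region {D Δ Y J K : ℕ} {w : Code} :
    w ∈ region D Δ Y J K ↔ InRegion D Δ Y J K w := by
  classical
  simp only [region, Finset.mem_union, Finset.mem_image, Finset.mem_product, mem_targets,
    leafBox, midBox, Finset.mem_range, Fintype.mem_piFinset]
  constructor
  · rintro (⟨e, h, rfl⟩ | ⟨e, h, rfl⟩ | ⟨e, h, rfl⟩)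
    · exact h
    · exact ⟨Nat.lt_succ_iff.1 h.1, h.2⟩
    · exact ⟨h.1.1, h.2, h.1.2⟩
  · intro h
    cases w with
    | leaf x y κ => exact Or.inl ⟨(x, y, κ), h, rfl⟩
    | mid j x y => exact Or.inr (Or.inl ⟨(j, x, y), ⟨Nat.lt_succ_iff.2 h.1, h.2⟩, rfl⟩)
    | rail g j i => exact Or.inr (Or.inr ⟨((g, i), j), ⟨⟨h.1, h.2.2⟩, h.2.1⟩, rfl⟩)
    | pad i => exact h.elim

/-- Edges `enter` and `next` are determined by their tails and edges `exit` by their heads, which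
gives `2 * Nat.card V`. Steps and padding edges are counted by their parameters. -/
theorem numEdges_le {V : Type*} [Finite V] {D Δ A B Y J K : ℕ} {G : Digraph V} {lab : V → Code}
    {vtx : Code → V} (hG : IsHardInstance D Δ A B Y J K G lab vtx)
    (hinv : ∀ v, vtx (lab v) = v) (hlab : ∀ v, InRegion D Δ Y J K (lab v) ∨ ∃ i, lab v = .pad i) :
    numEdges G ≤ A * B + midCard D Δ Y * Δ + 2 * Nat.card V := by
  classical
  have := Fintype.ofFinite V
  let f₁ : V → V × V := fun v => (v, vtx (match lab v with
    | .leaf x y _ => .mid 0 (D • x) y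
    | .rail g j i => .rail g j (i + 1)
    | w => w))
  let f₂ : V → V × V := fun v => (vtx (match lab v with
    | .rail g _ i => .mid (3 * D) (D • g) i
    | w => w), v)
  let f₃ : (ℕ × (Fin 3 → ℕ) × ℕ) × ℕ → V × V := fun e =>
    (vtx (.mid e.1.1 e.1.2.1 e.1.2.2), vtx (.mid (e.1.1 + 1)
      (e.1.2.1 + fun i => if dir e.1.1 = i then e.2 else 0) (e.1.2.2 + e.2 ^ 2)))
  let f₄ : ℕ × ℕ → V × V := fun e => (vtx (.pad e.1), vtx (.pad e.2))
  let E : Finset (V × V) := (((Finset.range A ×ˢ Finset.Ico A (A + B)).image f₄ ∪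
    (midBox D Δ Y ×ˢ Finset.range Δ).image f₃) ∪ (Finset.univ.image f₁ ∪ Finset.univ.image f₂))
  have hE : {e : V × V | G.Adj e.1 e.2} ⊆ E := by
    rintro ⟨u, v⟩ huv
    have h := (hG.adj_iff u v).1 huv
    simp only [E, Finset.coe_union, Set.mem_union, Finset.mem_coe, Finset.mem_image,
      Finset.mem_univ, true_and]
    have hu := hlab u
    rw [← hinv u, ← hinv v]
    generalize hlu : lab u = lu at h hu
    generalize hlv : lab v = lv at h
    cases h with
    | enter x y κ => exact Or.inr (Or.inl ⟨u, by simp only [f₁, hlu]; rw [← hinv u, hlu]⟩)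
    | step j x y a ha =>
      rcases hu with hu | ⟨i, hi⟩
      · refine Or.inl (Or.inr ⟨((j, x, y), a), ?_, rfl⟩)
        simp only [Finset.mem_product, midBox, Finset.mem_range, Fintype.mem_piFinset]
        exact ⟨⟨Nat.lt_succ_iff.2 hu.1, hu.2⟩, ha⟩
      · cases hi
    | exit x g l j i hl hx =>
      refine Or.inr (Or.inr ⟨v, ?_⟩)
      subst hl hx
      simp only [f₂, hlv]
      rw [← hinv v, hlv]
    | next g j i => exact Or.inr (Or.inl ⟨u, by simp only [f₁, hlu]; rw [← hinv u, hlu]⟩)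
    | pad i j hi hj hj' =>
      refine Or.inl (Or.inl ⟨(i, j), ?_, rfl⟩)
      simp only [Finset.mem_product, Finset.mem_range, Finset.mem_Ico]
      exact ⟨hi, hj, hj'⟩
  have h1 : numEdges G ≤ E.card := by
    rw [← Set.ncard_coe_finset]
    exact Set.ncard_le_ncard hE (Set.toFinite _)
  refine h1.trans ((Finset.card_union_le _ _).trans (Nat.add_le_add
    ((Finset.card_union_le _ _).trans (Nat.add_le_add ?_ ?_))
    ((Finset.card_union_le _ _).trans ?_)))
  · refine Finset.card_image_le.trans (le_of_eq ?_)
    simp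
  · refine Finset.card_image_le.trans (le_of_eq ?_)
    rw [Finset.card_product, card_midBox, Finset.card_range]
  · rw [two_mul, Nat.card_eq_fintype_card]
    exact Nat.add_le_add Finset.card_image_le Finset.card_image_le

theorem le_numEdges {V : Type*} [Finite V] {D Δ A B Y J K : ℕ} {G : Digraph V} {lab : V → Code}
    {vtx : Code → V} (hG : IsHardInstance D Δ A B Y J K G lab vtx)
    (hpad : ∀ i < A + B, lab (vtx (.pad i)) = .pad i) : A * B ≤ numEdges G := by
  have hinj : ∀ i < A + B, ∀ j < A + B, vtx (.pad i) = vtx (.pad j) → i = j := by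
    intro i hi j hj hij
    have := congrArg lab hij
    rw [hpad i hi, hpad j hj] at this
    exact Code.pad.inj this
  have hcard : (Finset.range A ×ˢ Finset.Ico A (A + B)).card = A * B := by simp
  rw [← hcard, ← Set.ncard_coe_finset]
  refine Set.ncard_le_ncard_of_injOn (fun e => (vtx (.pad e.1), vtx (.pad e.2))) ?_ ?_
    (Set.toFinite _)
  · rintro ⟨i, j⟩ he
    simp only [Finset.mem_coe, Finset.mem_product, Finset.mem_range, Finset.mem_Ico] at he
    simp only [Set.mem_ofPred_eq]
    rw [hG.adj_iff, hpad _ (by omega), hpad _ (by omega)]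
    exact CodeAdj.pad _ _ he.1 he.2.1 he.2.2
  · rintro ⟨i, j⟩ he ⟨i', j'⟩ he' h
    simp only [Finset.mem_coe, Finset.mem_product, Finset.mem_range, Finset.mem_Ico] at he he'
    simp only [Prod.mk.injEq] at h
    exact Prod.ext (hinj _ (by omega) _ (by omega) h.1) (hinj _ (by omega) _ (by omega) h.2)

/-- Hard instances exist on every vertex set that is large enough. -/
theorem exists_isHardInstance {D Δ A B Y J K n : ℕ} (hn : 0 < n)
    (h : regionCard D Δ Y J K + (A + B) ≤ n) :
    ∃ (G : Digraph (Fin n)) (lab : Fin n → Code) (vtx : Code → Fin n),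
      IsHardInstance D Δ A B Y J K G lab vtx ∧ A * B ≤ numEdges G ∧
      numEdges G ≤ A * B + midCard D Δ Y * Δ + 2 * n := by
  classical
  have hR := card_region_le D Δ Y J K
  set R := region D Δ Y J K
  -- Padding vertices fill up to exactly `n`; those with index at least `A + B` are isolated.
  let S : Finset Code := R ∪ (Finset.range (n - R.card)).image Code.pad
  have hS : S.card = n := by
    rw [Finset.card_union_of_disjoint, Finset.card_image_of_injective _
      (fun i j hij => Code.pad.inj hij), Finset.card_range]
    · omega
    · rw [Finset.disjoint_left]
      intro w hw hw'
      obtain ⟨i, -, rfl⟩ := Finset.mem_image.1 hw'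
      exact mem_region.1 hw
  let e := Finset.equivFinOfCardEq hS
  let lab : Fin n → Code := fun v => (e.symm v).1
  let vtx : Code → Fin n := fun w => if hw : w ∈ S then e ⟨w, hw⟩ else ⟨0, hn⟩
  have hlv : ∀ w ∈ S, lab (vtx w) = w := fun w hw => by simp [lab, vtx, hw]
  have hvl : ∀ v, vtx (lab v) = v := fun v => by simp [lab, vtx]
  have hG : IsHardInstance D Δ A B Y J K ⟨fun u v => CodeAdj D Δ A B (lab u) (lab v)⟩ lab vtx :=
    ⟨fun u v huv => by rw [← hvl u, huv, hvl v], fun u v => Iff.rfl,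
      fun w hw => hlv w (Finset.mem_union_left _ (mem_region.2 hw))⟩
  refine ⟨_, lab, vtx, hG, le_numEdges hG fun i hi => hlv _ ?_, ?_⟩
  · exact Finset.mem_union_right _ (Finset.mem_image_of_mem _ (Finset.mem_range.2 (by omega)))
  · have := numEdges_le hG hvl fun v => ?_
    · simpa using this
    · rcases Finset.mem_union.1 (e.symm v).2 with hv | hv
      · exact Or.inl (mem_region.1 hv)
      · obtain ⟨i, -, hi⟩ := Finset.mem_image.1 hv
        exact Or.inr ⟨i, hi.symm⟩

end Construction

/-! ### Choice of parameters and asymptotic estimates -/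

section Asymptotics

/-- The integer part of the `E`-th root of `n`. -/
noncomputable def root (E n : ℕ) : ℕ := ⌊(n : ℝ) ^ (1 / E : ℝ)⌋₊

theorem root_pow_le {E : ℕ} (hE : 0 < E) (n : ℕ) : root E n ^ E ≤ n := by
  have h0 : (0 : ℝ) ≤ (n : ℝ) ^ (1 / E : ℝ) := by positivity
  have h1 : (root E n : ℝ) ^ E ≤ ((n : ℝ) ^ (1 / E : ℝ)) ^ E :=
    pow_le_pow_left₀ (by positivity) (Nat.floor_le h0) E
  rw [one_div, Real.rpow_inv_natCast_pow (Nat.cast_nonneg n) hE.ne'] at h1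
  exact_mod_cast h1

theorem tendsto_root {E : ℕ} (hE : 0 < E) : Tendsto (root E) atTop atTop :=
  tendsto_nat_floor_atTop.comp ((tendsto_rpow_atTop (by positivity)).comp
    tendsto_natCast_atTop_atTop)

/-- The base `root E n + 1` exceeds `n ^ (1 / E)` and is at least `1`, so both it and the exponent
may be rounded up. -/
theorem rpow_le_root {E : ℕ} (hE : 0 < E) (n : ℕ) {s : ℝ} {e : ℕ} (hs : 0 ≤ s)
    (he : s * E ≤ e) : (n : ℝ) ^ s ≤ ((root E n : ℝ) + 1) ^ e := by
  have hE' : (E : ℝ) ≠ 0 := by positivity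
  have h1 : (n : ℝ) ^ s = ((n : ℝ) ^ (1 / E : ℝ)) ^ (s * E) := by
    rw [← Real.rpow_mul (Nat.cast_nonneg n)]
    congr 1
    field_simp
  rw [h1, ← Real.rpow_natCast]
  calc ((n : ℝ) ^ (1 / E : ℝ)) ^ (s * E) ≤ ((root E n : ℝ) + 1) ^ (s * E) :=
        Real.rpow_le_rpow (by positivity) (Nat.lt_floor_add_one _).le (by positivity)
    _ ≤ ((root E n : ℝ) + 1) ^ (e : ℝ) :=
        Real.rpow_le_rpow_of_exponent_le (by linarith [Nat.cast_nonneg (α := ℝ) (root E n)]) he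

theorem add_one_pow_le {N : ℝ} (hN : 1 ≤ N) (e : ℕ) : (N + 1) ^ e ≤ 2 ^ e * N ^ e := by
  rw [← mul_pow]
  exact pow_le_pow_left₀ (by linarith) (by linarith) e

theorem eventually_mul_add_one_pow_le {E : ℕ} (hE : 0 < E) (c : ℝ) {e f : ℕ} (hef : e < f) :
    ∀ᶠ n in atTop, c * ((root E n : ℝ) + 1) ^ e ≤ ((root E n ^ f : ℕ) : ℝ) := by
  have h : Tendsto (fun n => (root E n : ℝ)) atTop atTop :=
    tendsto_natCast_atTop_atTop.comp (tendsto_root hE)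
  filter_upwards [h.eventually_ge_atTop 1, h.eventually_ge_atTop (|c| * 2 ^ e)] with n h1 h2
  calc c * ((root E n : ℝ) + 1) ^ e ≤ |c| * (2 ^ e * (root E n : ℝ) ^ e) :=
        mul_le_mul (le_abs_self c) (add_one_pow_le h1 e) (by positivity) (abs_nonneg c)
    _ = (|c| * 2 ^ e) * (root E n : ℝ) ^ e := by ring
    _ ≤ (root E n : ℝ) * (root E n : ℝ) ^ e := mul_le_mul_of_nonneg_right h2 (by positivity)
    _ = (root E n : ℝ) ^ (e + 1) := by ring
    _ ≤ (root E n : ℝ) ^ f := pow_le_pow_right₀ h1 hef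
    _ = ((root E n ^ f : ℕ) : ℝ) := (Nat.cast_pow _ _).symm

theorem eventually_rpow_le_root_pow {E : ℕ} (hE : 0 < E) (e : ℕ) :
    ∃ c : ℝ, 0 < c ∧ ∀ᶠ n : ℕ in atTop,
      c * (n : ℝ) ^ (e / E : ℝ) ≤ ((root E n ^ e : ℕ) : ℝ) := by
  refine ⟨1 / 2 ^ e, by positivity, ?_⟩
  have h : Tendsto (fun n => (root E n : ℝ)) atTop atTop :=
    tendsto_natCast_atTop_atTop.comp (tendsto_root hE)
  filter_upwards [h.eventually_ge_atTop 1] with n h1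
  have hE' : (E : ℝ) ≠ 0 := by positivity
  have h2 := rpow_le_root hE n (s := e / E) (e := e) (by positivity)
    (by rw [div_mul_cancel₀ _ hE'])
  calc (1 / 2 ^ e : ℝ) * (n : ℝ) ^ (e / E : ℝ) ≤ 1 / 2 ^ e * (2 ^ e * (root E n : ℝ) ^ e) :=
        mul_le_mul_of_nonneg_left (h2.trans (add_one_pow_le h1 e)) (by positivity)
    _ = ((root E n ^ e : ℕ) : ℝ) := by
        rw [Nat.cast_pow]
        field_simp

/-- A sample of `M` elements with probability `p ≈ n⁻ˢ` is empty with negligible probability if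
`M` is polynomially larger than `nˢ`. -/
theorem eventually_pow_le_one_div {p : ℕ → unitInterval} {s : ℝ}
    (hp : IsSoftTheta (fun n => (p n : ℝ)) fun n => (n : ℝ) ^ (-s)) {M : ℕ → ℕ} {c δ : ℝ}
    (hc : 0 < c) (hδ : 0 < δ) (hM : ∀ᶠ n : ℕ in atTop, c * (n : ℝ) ^ (s + δ) ≤ M n) (K : ℕ) :
    ∀ᶠ n : ℕ in atTop, (1 - (p n : ℝ)) ^ M n ≤ 1 / (n : ℝ) ^ K := by
  obtain ⟨a, A, b, ha, -, hpa⟩ := hp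
  -- Of the `b + 1` logarithms, `b` offset the loss in the lower bound for `p` and one turns the
  -- exponential into `n ^ (-K)`.
  have hlog : ∀ᶠ n : ℕ in atTop, (K : ℝ) * Real.log n ^ (b + 1) ≤ a * c * (n : ℝ) ^ δ := by
    have h1 := (isLittleO_log_rpow_rpow_atTop (b + 1 : ℕ) hδ).bound
      (show 0 < a * c / (K + 1) by positivity)
    filter_upwards [tendsto_natCast_atTop_atTop.eventually h1, eventually_ge_atTop 1] with n h2 hn
    have hl : 0 ≤ Real.log n := Real.log_natCast_nonneg n
    rw [Real.rpow_natCast, Real.norm_of_nonneg (by positivity),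
      Real.norm_of_nonneg (by positivity)] at h2
    calc (K : ℝ) * Real.log n ^ (b + 1) ≤ (K + 1) * Real.log n ^ (b + 1) :=
          mul_le_mul_of_nonneg_right (by linarith) (by positivity)
      _ ≤ (K + 1) * (a * c / (K + 1) * (n : ℝ) ^ δ) :=
          mul_le_mul_of_nonneg_left h2 (by positivity)
      _ = a * c * (n : ℝ) ^ δ := by field_simp
  filter_upwards [hpa, hM, hlog, eventually_ge_atTop 3] with n h1 h2 h3 hn
  have hn0 : (0 : ℝ) < n := by positivity
  have hl : 0 < Real.log n := Real.log_pos (by exact_mod_cast (by omega : 1 < n))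
  have hp1 : (p n : ℝ) ≤ 1 := (p n).2.2
  have key : (K : ℝ) * Real.log n ≤ p n * M n := by
    calc (K : ℝ) * Real.log n = K * Real.log n ^ (b + 1) / Real.log n ^ b := by
          field_simp
          ring
      _ ≤ a * c * (n : ℝ) ^ δ / Real.log n ^ b := by gcongr
      _ = (a * (n : ℝ) ^ (-s) / Real.log n ^ b) * (c * (n : ℝ) ^ (s + δ)) := by
          rw [Real.rpow_add hn0, Real.rpow_neg hn0.le]
          have : (n : ℝ) ^ s ≠ 0 := by positivity
          field_simp
      _ ≤ p n * M n := mul_le_mul h1.1 h2 (by positivity) (p n).2.1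
  calc (1 - (p n : ℝ)) ^ M n ≤ Real.exp (-(p n : ℝ)) ^ M n :=
        pow_le_pow_left₀ (sub_nonneg.2 hp1) (Real.one_sub_le_exp_neg _) _
    _ = Real.exp (-(p n * M n)) := by
        rw [← Real.exp_nat_mul]
        congr 1
        ring
    _ ≤ Real.exp (-(K * Real.log n)) := Real.exp_le_exp.2 (by linarith)
    _ = 1 / (n : ℝ) ^ K := by
        rw [Real.exp_neg, mul_comm, Real.exp_mul, Real.exp_log hn0, Real.rpow_natCast, one_div]

theorem midCard_le {N : ℕ} (hN : 0 < N) :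
    midCard (N ^ 150) (N ^ 299) (N ^ 901) ≤ 64 * N ^ 2398 := by
  have h1 : 1 ≤ N ^ 150 := Nat.one_le_pow _ _ hN
  calc midCard (N ^ 150) (N ^ 299) (N ^ 901)
      ≤ (4 * N ^ 150) * ((2 * N ^ 299 * N ^ 150) ^ 3 * (2 * N ^ 901)) :=
        Nat.mul_le_mul_right _ (by omega)
    _ = 64 * N ^ 2398 := by ring

theorem midCard_mul_le {N : ℕ} (hN : 64 ≤ N) :
    midCard (N ^ 150) (N ^ 299) (N ^ 901) * N ^ 299 ≤ N ^ 2700 := by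
  calc midCard (N ^ 150) (N ^ 299) (N ^ 901) * N ^ 299
      ≤ 64 * N ^ 2398 * N ^ 299 := Nat.mul_le_mul_right _ (midCard_le (by omega))
    _ = 64 * N ^ 2697 := by ring
    _ ≤ N * N ^ 2697 := Nat.mul_le_mul_right _ hN
    _ = N ^ 2698 := (pow_succ' N 2697).symm
    _ ≤ N ^ 2700 := Nat.pow_le_pow_right (by omega) (by norm_num)

theorem regionCard_le {N : ℕ} (hN : 162 ≤ N) :
    2 * regionCard (N ^ 150) (N ^ 299) (N ^ 901) (N ^ 901) (N ^ 901) ≤ N ^ 2700 := by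
  have h1 := midCard_le (N := N) (by omega)
  have h2 : N ^ 2398 ≤ N ^ 2699 := Nat.pow_le_pow_right (by omega) (by norm_num)
  have h3 : (2 * N ^ 299) ^ 3 * (2 * N ^ 901 * N ^ 901) = 16 * N ^ 2699 := by ring
  have h4 : (N ^ 299) ^ 3 * N ^ 901 * N ^ 901 = N ^ 2699 := by ring
  calc 2 * regionCard (N ^ 150) (N ^ 299) (N ^ 901) (N ^ 901) (N ^ 901)
      ≤ 162 * N ^ 2699 := by
        unfold regionCard
        rw [h3, h4]
        omega
    _ ≤ N * N ^ 2699 := Nat.mul_le_mul_right _ hN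
    _ = N ^ 2700 := by ring

theorem three_mul_le {N : ℕ} (hN : 3 ≤ N) : 3 * N ^ 150 * (N ^ 299) ^ 2 ≤ N ^ 901 := by
  calc 3 * N ^ 150 * (N ^ 299) ^ 2 = 3 * N ^ 748 := by ring
    _ ≤ N * N ^ 748 := Nat.mul_le_mul_right _ hN
    _ = N ^ 749 := (pow_succ' N 748).symm
    _ ≤ N ^ 901 := Nat.pow_le_pow_right (by omega) (by norm_num)

theorem rails_card (N : ℕ) : (N ^ 299) ^ 3 * N ^ 901 * N ^ 901 = N ^ 2699 := by ring

theorem sixteen_mul_le {N : ℕ} (hN : 16 ≤ N) : 16 * (N ^ 299) ^ 3 * N ^ 901 ≤ N ^ 2700 := by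
  calc 16 * (N ^ 299) ^ 3 * N ^ 901 = 16 * N ^ 1798 := by ring
    _ ≤ N * N ^ 1798 := Nat.mul_le_mul_right _ hN
    _ = N ^ 1799 := (pow_succ' N 1798).symm
    _ ≤ N ^ 2700 := Nat.pow_le_pow_right (by omega) (by norm_num)

theorem le_longPairs_bound {N : ℕ} (hN : 0 < N) :
    N ^ 2845 ≤ (N ^ 299) ^ 3 * N ^ 901 * (N ^ 299) ^ 3 * (3 * N ^ 150 - 2) := by
  have h1 : 1 ≤ N ^ 150 := Nat.one_le_pow _ _ hN
  calc N ^ 2845 = (N ^ 299) ^ 3 * N ^ 901 * (N ^ 299) ^ 3 * N ^ 150 := by ring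
    _ ≤ _ := Nat.mul_le_mul_left _ (by omega)

theorem four_mul_add_le {T P U k : ℕ} (hU : 8 * U ≤ P) (hk : 8 * k ≤ T * P) :
    4 * (T * U + k) ≤ T * P := by
  have := Nat.mul_le_mul_left T hU
  have h3 : T * (8 * U) = 8 * (T * U) := by ring
  omega

end Asymptotics

/-- The growth of the parameters `D = N ^ 150`, `Δ = N ^ 299`, `Y = N ^ 901` of the hard
instances, where `N` is the integer part of `n ^ (1 / 2700)`. -/
theorem exists_parameters : ∃ D Δ Y : ℕ → ℕ,
    (∀ᶠ n : ℕ in atTop, 2 * regionCard (D n) (Δ n) (Y n) (Y n) (Y n) ≤ n) ∧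
    (∀ᶠ n : ℕ in atTop, midCard (D n) (Δ n) (Y n) * Δ n ≤ n) ∧
    (∀ᶠ n : ℕ in atTop, 0 < D n ∧ 2 ≤ Y n ∧ 3 * D n * Δ n ^ 2 ≤ Y n ∧
      16 * Δ n ^ 3 * Y n ≤ n) ∧
    (∀ᶠ n : ℕ in atTop, 8 * (n : ℝ) ^ (79 / 75 : ℝ) ≤
      ((Δ n ^ 3 * Y n * Δ n ^ 3 * (3 * D n - 2) : ℕ) : ℝ)) ∧
    (∀ c : ℝ, ∀ᶠ n : ℕ in atTop, c * (n : ℝ) ^ (1 / 3 : ℝ) ≤ Y n) ∧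
    (∀ c : ℝ, ∀ᶠ n : ℕ in atTop, c * (n : ℝ) ^ (2 / 3 : ℝ) ≤ ((Δ n ^ 3 * Y n * Y n : ℕ) : ℝ)) ∧
    ∃ c : ℝ, 0 < c ∧ ∀ᶠ n : ℕ in atTop, c * (n : ℝ) ^ (1 / 3 + 1 / 2700 : ℝ) ≤ Y n := by
  have hE : 0 < 2700 := by norm_num
  have hN := (tendsto_root hE).eventually_ge_atTop 162
  -- With `n ≈ N ^ 2700`, the value `Y = N ^ 901` is just above `n ^ (1 / 3)`; sources and rails
  -- number about `Δ ^ 3 * Y ^ 2 = N ^ 2699`, and layered edges about `D ^ 4 * Δ ^ 4 * Y = N ^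
  -- 2697`. The gain `Δ ^ 6 * Y * D = N ^ 2845` beats `n ^ (79 / 75) ≈ N ^ 2844`. The spare factors
  -- of `N` absorb all constants.
  obtain ⟨D, hD⟩ : ∃ D : ℕ → ℕ, ∀ n, D n = root 2700 n ^ 150 := ⟨_, fun _ => rfl⟩
  obtain ⟨Δ, hΔ⟩ : ∃ Δ : ℕ → ℕ, ∀ n, Δ n = root 2700 n ^ 299 := ⟨_, fun _ => rfl⟩
  obtain ⟨Y, hY⟩ : ∃ Y : ℕ → ℕ, ∀ n, Y n = root 2700 n ^ 901 := ⟨_, fun _ => rfl⟩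
  refine ⟨D, Δ, Y, ?_, ?_, ?_, ?_, fun c => ?_, fun c => ?_, ?_⟩
  · filter_upwards [hN] with n hn
    rw [hD, hΔ, hY]
    exact (regionCard_le hn).trans (root_pow_le hE n)
  · filter_upwards [hN] with n hn
    rw [hD, hΔ, hY]
    exact (midCard_mul_le (by omega)).trans (root_pow_le hE n)
  · filter_upwards [hN] with n hn
    have h1 := root_pow_le hE n
    rw [hD, hΔ, hY]
    generalize root 2700 n = N at hn h1
    exact ⟨pow_pos (by omega) _, le_trans (by omega) (Nat.le_self_pow (by norm_num) N),
      three_mul_le (by omega), (sixteen_mul_le (by omega)).trans h1⟩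
  · filter_upwards [hN, eventually_mul_add_one_pow_le hE 8 (by norm_num : 2844 < 2845)]
      with n hn h
    have h1 := rpow_le_root hE n (s := 79 / 75) (e := 2844) (by norm_num) (by norm_num)
    have h2 := le_longPairs_bound (N := root 2700 n) (by omega)
    rw [hD, hΔ, hY]
    exact (mul_le_mul_of_nonneg_left h1 (by norm_num)).trans (h.trans (Nat.cast_le.2 h2))
  · filter_upwards [eventually_mul_add_one_pow_le hE |c| (by norm_num : 900 < 901)] with n h
    have h1 := rpow_le_root hE n (s := 1 / 3) (e := 900) (by norm_num) (by norm_num)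
    rw [hY]
    exact (mul_le_mul (le_abs_self c) h1 (by positivity) (abs_nonneg c)).trans h
  · filter_upwards [eventually_mul_add_one_pow_le hE |c| (by norm_num : 1800 < 2699)] with n h
    have h1 := rpow_le_root hE n (s := 2 / 3) (e := 1800) (by norm_num) (by norm_num)
    rw [hΔ, hY, rails_card]
    exact (mul_le_mul (le_abs_self c) h1 (by positivity) (abs_nonneg c)).trans h
  · obtain ⟨c, hc, h⟩ := eventually_rpow_le_root_pow hE 901
    refine ⟨c, hc, ?_⟩
    filter_upwards [h] with n h
    have : ((901 : ℕ) / (2700 : ℕ) : ℝ) = 1 / 3 + 1 / 2700 := by norm_num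
    rw [this] at h
    rwa [hY]

/-- The size of the padding. -/
theorem eventually_padding {ε : ℝ} (hε₀ : 0 ≤ ε) (hε₁ : ε < 1) : ∀ᶠ n : ℕ in atTop,
    n / 4 + ⌊(n : ℝ) ^ ε⌋₊ ≤ n / 2 ∧
    (1 / 16 : ℝ) * (n : ℝ) ^ (1 + ε) ≤ ((n / 4 * ⌊(n : ℝ) ^ ε⌋₊ : ℕ) : ℝ) ∧
    ((n / 4 * ⌊(n : ℝ) ^ ε⌋₊ : ℕ) : ℝ) ≤ (n : ℝ) ^ (1 + ε) := by
  have h1 : Tendsto (fun n : ℕ => (n : ℝ) ^ (1 - ε)) atTop atTop :=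
    (tendsto_rpow_atTop (by linarith)).comp tendsto_natCast_atTop_atTop
  filter_upwards [h1.eventually_ge_atTop 4, eventually_ge_atTop 8] with n h hn
  have hn0 : (0 : ℝ) < n := by positivity
  have hn1 : (1 : ℝ) ≤ n := by exact_mod_cast (by omega : 1 ≤ n)
  replace h : 4 * (n : ℝ) ^ ε ≤ n := by
    calc 4 * (n : ℝ) ^ ε ≤ (n : ℝ) ^ (1 - ε) * (n : ℝ) ^ ε := by gcongr
      _ = n := by rw [← Real.rpow_add hn0, sub_add_cancel, Real.rpow_one]
  have hpow : (1 : ℝ) ≤ (n : ℝ) ^ ε := Real.one_le_rpow hn1 hε₀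
  have hfl := Nat.floor_le (zero_le_one.trans hpow)
  have hfl1 : 1 ≤ ⌊(n : ℝ) ^ ε⌋₊ := Nat.one_le_floor_iff _ |>.2 hpow
  have hfl2 := Nat.lt_floor_add_one ((n : ℝ) ^ ε)
  have hfl1' : (1 : ℝ) ≤ (⌊(n : ℝ) ^ ε⌋₊ : ℝ) := by exact_mod_cast hfl1
  have hq1 : ((n / 4 : ℕ) : ℝ) ≤ n / 4 := by simpa using Nat.cast_div_le (α := ℝ) (m := n) (n := 4)
  have hq2 : (n : ℝ) / 8 ≤ ((n / 4 : ℕ) : ℝ) := by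
    have : n ≤ 8 * (n / 4) := by omega
    have : (n : ℝ) ≤ 8 * ((n / 4 : ℕ) : ℝ) := by exact_mod_cast this
    linarith
  rw [Real.rpow_add hn0, Real.rpow_one]
  refine ⟨?_, ?_, ?_⟩
  · have : ⌊(n : ℝ) ^ ε⌋₊ ≤ n / 4 := by
      rw [Nat.le_div_iff_mul_le (by norm_num)]
      have : (⌊(n : ℝ) ^ ε⌋₊ : ℝ) * 4 ≤ n := by linarith
      exact_mod_cast this
    omega
  · push_cast
    calc (1 / 16 : ℝ) * (n * (n : ℝ) ^ ε) = (n / 8) * ((n : ℝ) ^ ε / 2) := by ring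
      _ ≤ _ := mul_le_mul hq2 (by linarith) (by positivity) (by positivity)
  · push_cast
    exact mul_le_mul (by linarith) hfl (by positivity) hn0.le

end CertShortcut

/-! ### Assembly of the main theorem -/

theorem mainTheorem8 (ε : ℝ) (hε₀ : 0 ≤ ε) (hε₁ : ε < 2 / 75) (C : ℝ) (hC : 1 ≤ C) :
    ∃ (G : ∀ n : ℕ, Digraph (Fin n)) (c₁ c₂ c₃ : ℝ), 0 < c₁ ∧ 0 < c₂ ∧ 0 < c₃ ∧
      (∀ n, CertShortcut.IsDAG (G n)) ∧
      (∀ᶠ n : ℕ in Filter.atTop,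
        c₁ * (n : ℝ) ^ (1 + ε) ≤ (CertShortcut.numEdges (G n) : ℝ) ∧
        (CertShortcut.numEdges (G n) : ℝ) ≤ c₂ * (n : ℝ) ^ (1 + ε)) ∧
      ∀ p q : ℕ → unitInterval,
        CertShortcut.IsSoftTheta (fun n => (p n : ℝ)) (fun n => (n : ℝ) ^ (-(1 / 3) : ℝ)) →
        CertShortcut.IsSoftTheta (fun n => (q n : ℝ)) (fun n => (n : ℝ) ^ (-(1 / 3) : ℝ)) →
        ∀ K : ℕ, ∀ᶠ n : ℕ in Filter.atTop,
          ∀ (ℓ k : ℕ) (c : Fin k → List (Fin n)) (H₁ : Set (Fin n × Fin n)),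
            (n : ℝ) ^ (2 / 3 : ℝ) / C ≤ (ℓ : ℝ) → (ℓ : ℝ) ≤ C * (n : ℝ) ^ (2 / 3 : ℝ) →
            CertShortcut.IsChainCover (G n) c ℓ C →
            CertShortcut.IsShortcut (G n) H₁ →
            1 - 1 / (n : ℝ) ^ K ≤
              (CertShortcut.sampleLaw (Fin n) k (p n) (q n)).real
                {s | c₃ * ((CertShortcut.numEdges (G n) : ℝ) * (n : ℝ) ^ ε) ≤
                  (CertShortcut.certificationComplexity (G n)
                    (CertShortcut.koganParter (G n) c H₁ s.1 s.2) : ℝ)} := by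
  open CertShortcut in
  obtain ⟨D, Δ, Y, hregion, hmid, hsmall, hlong, hY, hYY, c, hc, hYc⟩ := exists_parameters
  have hgraph : ∀ n : ℕ, ∃ G : Digraph (Fin n), IsDAG G ∧
      (0 < n → regionCard (D n) (Δ n) (Y n) (Y n) (Y n) + (n / 4 + ⌊(n : ℝ) ^ ε⌋₊) ≤ n →
        ∃ (lab : Fin n → Code) (vtx : Code → Fin n),
          IsHardInstance (D n) (Δ n) (n / 4) ⌊(n : ℝ) ^ ε⌋₊ (Y n) (Y n) (Y n) G lab vtx ∧
          n / 4 * ⌊(n : ℝ) ^ ε⌋₊ ≤ numEdges G ∧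
          numEdges G ≤ n / 4 * ⌊(n : ℝ) ^ ε⌋₊ + midCard (D n) (Δ n) (Y n) * Δ n + 2 * n) := by
    intro n
    by_cases h : 0 < n ∧
        regionCard (D n) (Δ n) (Y n) (Y n) (Y n) + (n / 4 + ⌊(n : ℝ) ^ ε⌋₊) ≤ n
    · obtain ⟨G, lab, vtx, hG, h1, h2⟩ := exists_isHardInstance h.1 h.2
      exact ⟨G, hG.isDAG, fun _ _ => ⟨lab, vtx, hG, h1, h2⟩⟩
    -- For the finitely many `n` too small for the construction, the empty graph serves.
    · refine ⟨⟨fun _ _ => False⟩, fun v hv => ?_, fun h1 h2 => absurd ⟨h1, h2⟩ h⟩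
      obtain ⟨w, hw, -⟩ := Relation.TransGen.head'_iff.1 hv
      exact hw
  choose G hdag hG using hgraph
  replace hG : ∀ᶠ n : ℕ in atTop, ∃ (lab : Fin n → Code) (vtx : Code → Fin n),
      IsHardInstance (D n) (Δ n) (n / 4) ⌊(n : ℝ) ^ ε⌋₊ (Y n) (Y n) (Y n) (G n) lab vtx ∧
      (1 / 16 : ℝ) * (n : ℝ) ^ (1 + ε) ≤ (numEdges (G n) : ℝ) ∧
      (numEdges (G n) : ℝ) ≤ 4 * (n : ℝ) ^ (1 + ε) := by
    filter_upwards [hregion, hmid, eventually_padding hε₀ (by linarith), eventually_ge_atTop 1]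
      with n h1 h2 ⟨h3, h4, h5⟩ hn
    obtain ⟨lab, vtx, hI, h6, h7⟩ := hG n hn (by omega)
    refine ⟨lab, vtx, hI, h4.trans (Nat.cast_le.2 h6), ?_⟩
    have h8 : numEdges (G n) ≤ n / 4 * ⌊(n : ℝ) ^ ε⌋₊ + 3 * n := by omega
    have h9 : (numEdges (G n) : ℝ) ≤ ((n / 4 * ⌊(n : ℝ) ^ ε⌋₊ : ℕ) : ℝ) + 3 * n := by
      exact_mod_cast h8
    have h10 : (n : ℝ) ≤ (n : ℝ) ^ (1 + ε) := by
      have := Real.rpow_le_rpow_of_exponent_le (x := n) (by exact_mod_cast hn)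
        (show (1 : ℝ) ≤ 1 + ε by linarith)
      rwa [Real.rpow_one] at this
    linarith
  refine ⟨G, 1 / 16, 4, 1 / 4, by norm_num, by norm_num, by norm_num, hdag, ?_, ?_⟩
  · filter_upwards [hG] with n ⟨_, _, _, h⟩
    exact h
  intro p q hp hq K
  -- Each of the two families has at most `n` members, so exponent `K + 2` leaves a total failure
  -- probability of at most `2 / n * n ^ (-K)`.
  have hMp := eventually_pow_le_one_div hp hc (by norm_num : (0 : ℝ) < 1 / 2700) hYc (K + 2)
  have hYc' : ∀ᶠ n : ℕ in atTop,
      c / 3 * (n : ℝ) ^ (1 / 3 + 1 / 2700 : ℝ) ≤ ((Y n / 2 : ℕ) : ℝ) := by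
    filter_upwards [hYc, hsmall] with n h1 ⟨_, h2, _⟩
    have : Y n ≤ 3 * (Y n / 2) := by omega
    have : (Y n : ℝ) ≤ 3 * ((Y n / 2 : ℕ) : ℝ) := by exact_mod_cast this
    linarith
  have hMq := eventually_pow_le_one_div hq (by positivity : 0 < c / 3)
    (by norm_num : (0 : ℝ) < 1 / 2700) hYc' (K + 2)
  -- The constants come from `C * n / ℓ ≤ C ^ 2 * n ^ (1 / 3)` for the uncovered vertices and `k ≤ ℓ
  -- ≤ C * n ^ (2 / 3)` for the chains.
  filter_upwards [hG, hsmall, hlong, hY (8 * C ^ 2), hYY (8 * C), hMp, hMq,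
    eventually_ge_atTop 2] with n ⟨lab, vtx, hI, hm1, hm2⟩ ⟨hD, hY2, hDY, hΔY⟩ hlong hYn hYYn
    hpn hqn hn ℓ k c H₁ hℓ1 hℓ2 hcov hH₁
  have hn0 : (0 : ℝ) < n := by positivity
  have hn1 : (1 : ℝ) ≤ n := by exact_mod_cast (by omega : 1 ≤ n)
  have hC0 : 0 < C := by linarith
  have hU : ∀ P : List (Fin n), P.Nodup → P.IsChain (G n).Adj →
      {v | v ∈ P ∧ ∀ i, v ∉ c i}.ncard ≤ ⌊C * ((n : ℝ) / ℓ)⌋₊ := by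
    intro P h1 h2
    have := hcov.uncovered_le P h1 h2
    rw [Nat.card_fin] at this
    exact Nat.le_floor this
  have hU8 : 8 * ⌊C * ((n : ℝ) / ℓ)⌋₊ ≤ Y n := by
    have h1 : C * ((n : ℝ) / ℓ) ≤ C ^ 2 * (n : ℝ) ^ (1 / 3 : ℝ) := by
      calc C * ((n : ℝ) / ℓ) ≤ C * ((n : ℝ) / ((n : ℝ) ^ (2 / 3 : ℝ) / C)) := by gcongr
        _ = C ^ 2 * ((n : ℝ) ^ (1 : ℝ) / (n : ℝ) ^ (2 / 3 : ℝ)) := by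
          rw [Real.rpow_one]
          field_simp
        _ = C ^ 2 * (n : ℝ) ^ (1 / 3 : ℝ) := by
          rw [← Real.rpow_sub hn0]
          norm_num
    have h2 := Nat.floor_le (show 0 ≤ C * ((n : ℝ) / ℓ) by positivity)
    have : 8 * (⌊C * ((n : ℝ) / ℓ)⌋₊ : ℝ) ≤ Y n := by linarith
    exact_mod_cast this
  have hk8 : 8 * k ≤ Δ n ^ 3 * Y n * Y n := by
    have h1 : (k : ℝ) ≤ ℓ := by exact_mod_cast hcov.card_le
    have : 8 * (k : ℝ) ≤ ((Δ n ^ 3 * Y n * Y n : ℕ) : ℝ) := by linarith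
    exact_mod_cast this
  have key := hI.one_sub_le_prob hD (by omega) hDY hcov.isChain hU
    (four_mul_add_le hU8 hk8) hH₁ (p n) (q n)
  refine le_trans ?_ (key.trans (measureReal_mono ?_))
  · have hΔY1 : 16 * (Δ n : ℝ) ^ 3 * Y n ≤ n := by exact_mod_cast hΔY
    have hΔY2 : (Δ n : ℝ) ^ 3 * Y n ≤ n := by
      have : 0 ≤ (Δ n : ℝ) ^ 3 * Y n := by positivity
      linarith
    have e1 := mul_le_mul hΔY1 hpn (pow_nonneg (sub_nonneg.2 (p n).2.2) _) hn0.le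
    have e2 := mul_le_mul hΔY2 hqn (pow_nonneg (sub_nonneg.2 (q n).2.2) _) hn0.le
    have e3 : (n : ℝ) * (1 / (n : ℝ) ^ (K + 2)) + n * (1 / (n : ℝ) ^ (K + 2)) =
        2 / n * (1 / (n : ℝ) ^ K) := by
      field_simp
      ring
    have e4 : 2 / (n : ℝ) * (1 / (n : ℝ) ^ K) ≤ 1 * (1 / (n : ℝ) ^ K) := by
      refine mul_le_mul_of_nonneg_right ?_ (by positivity)
      rw [div_le_one hn0]
      exact_mod_cast hn
    linarith
  · intro s hs
    simp only [Set.mem_ofPred_eq] at hs ⊢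
    have e1 := hlong.trans (Nat.cast_le.2 hs)
    have e2 : (n : ℝ) ^ (1 + ε) * (n : ℝ) ^ ε ≤ (n : ℝ) ^ (79 / 75 : ℝ) := by
      rw [← Real.rpow_add hn0]
      exact Real.rpow_le_rpow_of_exponent_le hn1 (by linarith)
    have e3 := mul_le_mul_of_nonneg_right hm2 (by positivity : 0 ≤ (n : ℝ) ^ ε)
    push_cast at e1
    linarith
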